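/- Let $n,k\ge 0$ be integers with $k+1\le n$, let $x=(x_1,\dots,x_{n-k-1})\in\mathbb{C}^{n-k-1}$ with $|x_i|<1$ for all $i$, let $t\in\mathbb{C}$, and let $\epsilon_1,\dots,\epsilon_{k+1}>0$ be real numbers with $|t|(1+\epsilon_i)<1$ for all $i$ (for $t\neq 0$ this says $\epsilon_i<|t^{-1}|-1$). For partitions $\lambda,\mu$ let $$s_{\lambda/\mu}(x_1,\dots,x_l)=\sum_{T}x^T$$ be the skew Schur function, the sum being over all semistandard Young tableaux $T$ of shape $\lambda/\mu$ with entries in $\{1,\dots,l\}$ (weakly increasing along rows, strictly increasing down columns; $x^T=\prod_{c}x_{T(c)}$ over the boxes $c$ of $\lambda/\mu$; so $s_{\lambda/\mu}=0$ unless $\mu\subseteq\lambda$), and let $\ell(\lambda)$ be the number of parts of $\lambda$. Then the series $$S_{n,k}(x;t)=\sum_{\lambda,\mu\,:\,\ell(\lambda)\le n,\ \ell(\mu)\le k+1}s_{\lambda/\mu}(x_1,\dots,x_{n-k-1})\,t^{|\mu|}$$ converges absolutely, and $$S_{n,k}(x;t)=\frac{(-1)^{\binom{k+1}{2}}}{(k+1)!}\prod_{i=1}^{n-k-1}\frac{1}{1-x_i}\prod_{1\le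 i<j\le n-k-1}\frac{1}{1-x_ix_j}\cdot\frac{1}{(2\pi \mathrm{i})^{k+1}}\int_T F(y)\,dy_1\cdots dy_{k+1},$$ where $$F(y)=\prod_{1\le i<j\le k+1}\frac{(y_i-y_j)^2}{1-t^2y_iy_j}\ \prod_{i=1}^{n-k-1}\prod_{j=1}^{k+1}\frac{1}{1-x_ity_j}\ \prod_{i=1}^{k+1}\frac{1}{1-ty_i}\ \prod_{i=1}^{k+1}\frac{1}{y_i-1}\ \prod_{1\le i<j\le k+1}\frac{1}{y_iy_j-1}$$ and $T=C_1\times\cdots\times C_{k+1}$, where $C_i=\{z\in\mathbb{C}:|z|=1+\epsilon_i\}$ is positively oriented and $\mathrm{i}=\sqrt{-1}$; $F$ is integrable on $T$. -/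

import Mathlib

open scoped BigOperators

/-- The cells of the skew diagram `lam / mu`. -/
abbrev SkewCell (lam mu : YoungDiagram) : Type :=
  {c : ℕ × ℕ // c ∈ lam.cells \ mu.cells}

/-- A semistandard Young tableau of skew shape `lam / mu` (which presupposes `mu ⊆ lam`) with
entries in an alphabet of `l` letters: weakly increasing along rows, strictly increasing down
columns. The cell `(i, j)` lies in row `i` and column `j`. -/
def IsSkewSSYT {lam mu : YoungDiagram} {l : ℕ} (T : SkewCell lam mu → Fin l) : Prop :=
  mu ≤ lam ∧
  (∀ c d : SkewCell lam mu, c.1.1 = d.1.1 → c.1.2 < d.1.2 → T c ≤ T d) ∧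
  (∀ c d : SkewCell lam mu, c.1.2 = d.1.2 → c.1.1 < d.1.1 → T c < T d)

open Classical in
/-- The skew Schur function `s_{lam/mu}(x_1, …, x_l)`, the sum of the monomials `x^T` over all
semistandard tableaux `T` of shape `lam / mu` with entries in `1, …, l`
(zero when `mu` is not contained in `lam`, as there are no such tableaux). -/
noncomputable def skewSchur (lam mu : YoungDiagram) {l : ℕ} (x : Fin l → ℂ) : ℂ :=
  ∑ T : SkewCell lam mu → Fin l with IsSkewSSYT T, ∏ c, x (T c)

/-- The number of (nonzero) parts of a partition, i.e. of rows of its diagram. -/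
def partLength (lam : YoungDiagram) : ℕ := lam.colLen 0

/-- Pairs of partitions `(lam, mu)` with `ℓ(lam) ≤ n` and `ℓ(mu) ≤ k + 1`. -/
abbrev PartPair (n k : ℕ) : Type :=
  {p : YoungDiagram × YoungDiagram // partLength p.1 ≤ n ∧ partLength p.2 ≤ k + 1}

/-- The summand `s_{lam/mu}(x_1, …, x_{n-k-1}) t^{|mu|}`. -/
noncomputable def schurTerm (n k : ℕ) (x : Fin (n - k - 1) → ℂ) (t : ℂ) (p : PartPair n k) : ℂ :=
  skewSchur p.1.1 p.1.2 x * t ^ p.1.2.card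

/-- `S_{n,k}(x; t)`. -/
noncomputable def schurSum (n k : ℕ) (x : Fin (n - k - 1) → ℂ) (t : ℂ) : ℂ :=
  ∑' p : PartPair n k, schurTerm n k x t p

/-- The integrand, a rational function of `y = (y_1, …, y_p)`. -/
noncomputable def torusIntegrand {m p : ℕ} (x : Fin m → ℂ) (t : ℂ) (y : Fin p → ℂ) : ℂ :=
  (∏ i, ∏ j ∈ Finset.Ioi i, (y i - y j) ^ 2 / (1 - t ^ 2 * y i * y j)) *
  (∏ i, ∏ j, 1 / (1 - x i * t * y j)) *
  (∏ i, 1 / (1 - t * y i)) *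
  (∏ i, 1 / (y i - 1)) *
  (∏ i, ∏ j ∈ Finset.Ioi i, 1 / (y i * y j - 1))

/-! Write `a_μ(z)` for the alternant `det (z_i ^ (μ_j + q - 1 - j))` and `G_μ(x)` for the sum of
`s_{λ/μ}(x)` over all `λ` (`outerSkewSum`). A column-strict filling with `n - k - 1` letters adds at
most `n - k - 1` rows to `μ`, so the bound `ℓ(λ) ≤ n` is automatic and `S_{n,k}` is the sum of
`G_μ(x) t^|μ|` over `μ` with at most `p = k + 1` parts.

On the torus, `a_μ(y)` and `a_ν(1/y)` are orthogonal for the weight `∏ 1/y_i`, with norm `p!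
(2πi)^p`. Hence `S_{n,k}` is recovered by integrating `∑_μ G_μ(x) t^|μ| a_μ(y)` against `∑_ν
a_ν(1/y)` (`torusIntegral_tsum_alternant`). Both series converge because `|t y_i| < 1 < |y_i|`, and
both are explicit products, whose product is the integrand up to prefactors: each contributes one
Vandermonde factor to `(y_i - y_j)^2`, and inverting the variables produces the sign.

The second series is Littlewood's identity (`tsum_alternant`), by induction on the number of
variables. Splitting off a variable expands an alternant over horizontal strips (`alternant_cons`).
Adding a strip to a partition and removing one have the same generating function up to `1/(1 - x)`
(`tsum_interlaces_pow`). The removed strips are then resummed by the Pieri rule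
(`tsum_isHorizontalStrip_alternant`).

The first series is `tsum_outerSkewSum_alternant`, by induction on the number of letters. Deleting
the boxes with the smallest letter expands `G_μ` over the same strips (`skewSchurOver_succ`), so by
`alternant_cons` the letter `x_0` can be moved among the variables `z`, at the cost of a factor `∏
(x_0 - z_i)`; with no letters left, Littlewood's identity remains. -/

/-! ### Partitions as integer sequences, horizontal strips, and sums over them. -/

/-- Partitions with at most `q` parts, as weakly decreasing sequences of length `q`. -/
abbrev RowPartition (q : ℕ) : Type := {μ : Fin q → ℕ // Antitone μ}

/-- The sum of the parts. -/
def RowPartition.size {q : ℕ} (μ : RowPartition q) : ℕ := ∑ i, μ.1 i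

/-- `κ / μ` is a horizontal strip, where `κ` may have one part more than `μ`. -/
def Interlaces {q : ℕ} (κ : Fin (q + 1) → ℕ) (μ : Fin q → ℕ) : Prop :=
  ∀ i, κ i.succ ≤ μ i ∧ μ i ≤ κ i.castSucc

/-- `lam / μ` is a horizontal strip, both having at most `q + 1` parts. -/
def IsHorizontalStrip {q : ℕ} (lam μ : Fin (q + 1) → ℕ) : Prop :=
  μ 0 ≤ lam 0 ∧ ∀ i : Fin q, μ i.succ ≤ lam i.succ ∧ lam i.succ ≤ μ i.castSucc

instance {q : ℕ} (κ : Fin (q + 1) → ℕ) (μ : Fin q → ℕ) : Decidable (Interlaces κ μ) := by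
  unfold Interlaces; infer_instance

instance {q : ℕ} (lam μ : Fin (q + 1) → ℕ) : Decidable (IsHorizontalStrip lam μ) := by
  unfold IsHorizontalStrip; infer_instance

theorem summable_pow_sum (q : ℕ) {r : ℝ} (h0 : 0 ≤ r) (h1 : r < 1) :
    Summable fun s : Fin q → ℕ => r ^ ∑ i, s i := by
  induction q with
  | zero => exact (hasSum_fintype _).summable
  | succ q ih =>
    rw [← (Fin.consEquiv (fun _ : Fin (q + 1) => ℕ)).summable_iff]
    have := (summable_geometric_of_lt_one h0 h1).mul_of_nonneg ih
      (fun _ => pow_nonneg h0 _) (fun _ => pow_nonneg h0 _)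
    refine this.congr fun x => ?_
    simp [Fin.consEquiv, Fin.sum_univ_succ, pow_add]

theorem summable_pow_size (q : ℕ) {r : ℝ} (h0 : 0 ≤ r) (h1 : r < 1) :
    Summable fun μ : RowPartition q => r ^ μ.size :=
  (summable_pow_sum q h0 h1).comp_injective Subtype.val_injective

theorem Interlaces.sum_le {q : ℕ} {κ : Fin (q + 1) → ℕ} {μ : Fin q → ℕ} (h : Interlaces κ μ) :
    ∑ i, μ i ≤ ∑ i, κ i := by
  rw [Fin.sum_univ_castSucc]
  exact (Finset.sum_le_sum fun i _ => (h i).2).trans (Nat.le_add_right _ _)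

theorem IsHorizontalStrip.le {q : ℕ} {lam μ : Fin (q + 1) → ℕ} (h : IsHorizontalStrip lam μ) :
    μ ≤ lam := by
  intro i
  cases i using Fin.cases with
  | zero => exact h.1
  | succ i => exact (h.2 i).1

theorem IsHorizontalStrip.sum_le {q : ℕ} {lam μ : Fin (q + 1) → ℕ}
    (h : IsHorizontalStrip lam μ) : ∑ i, μ i ≤ ∑ i, lam i :=
  Finset.sum_le_sum fun i _ => h.le i

/-- The intervals are stacked in decreasing order, so monotonicity is automatic inside the box and
the parts vary independently. This is what turns sums over horizontal strips into products of
geometric sums. -/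
theorem tsum_rowPartition_of_box {q : ℕ} (lo hi : Fin q → ℕ) (h : ∀ i j, i < j → hi j ≤ lo i)
    (u : (Fin q → ℕ) → ℂ) :
    ∑' μ : RowPartition q, (if ∀ i, lo i ≤ μ.1 i ∧ μ.1 i ≤ hi i then u μ.1 else 0) =
      ∑ s ∈ Fintype.piFinset fun i => Finset.Icc (lo i) (hi i), u s := by
  have hanti : ∀ s ∈ Fintype.piFinset fun i => Finset.Icc (lo i) (hi i), Antitone s := by
    intro s hs i j hij
    simp only [Fintype.mem_piFinset, Finset.mem_Icc] at hs
    rcases hij.eq_or_lt with rfl | hij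
    · exact le_rfl
    · exact ((hs j).2.trans (h i j hij)).trans (hs i).1
  have := (Subtype.val_injective (p := fun s : Fin q → ℕ => Antitone s)).tsum_eq
    (f := fun s => if ∀ i, lo i ≤ s i ∧ s i ≤ hi i then u s else 0) ?_
  · rw [this, tsum_eq_sum (s := Fintype.piFinset fun i => Finset.Icc (lo i) (hi i))]
    · refine Finset.sum_congr rfl fun s hs => if_pos ?_
      simpa using hs
    · intro s hs
      exact if_neg (by simpa using hs)
  · intro s hs
    refine ⟨⟨s, hanti s ?_⟩, rfl⟩
    have : ∀ i, lo i ≤ s i ∧ s i ≤ hi i := by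
      by_contra hc
      exact hs (if_neg hc)
    simpa using this

/-- As for a box, except that the first part is unbounded above. Its excess over `c` is a free
natural number, so the partitions involved form a product of a finite box with `ℕ`. -/
theorem tsum_rowPartition_of_cone {q : ℕ} (c : ℕ) (lo hi : Fin q → ℕ)
    (h : ∀ i j, i < j → hi j ≤ lo i) (hc : ∀ i, hi i ≤ c) (u : (Fin (q + 1) → ℕ) → ℂ)
    (hu : Summable fun μ : RowPartition (q + 1) =>
      if c ≤ μ.1 0 ∧ ∀ i, lo i ≤ μ.1 i.succ ∧ μ.1 i.succ ≤ hi i then u μ.1 else 0) :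
    ∑' μ : RowPartition (q + 1),
        (if c ≤ μ.1 0 ∧ ∀ i, lo i ≤ μ.1 i.succ ∧ μ.1 i.succ ≤ hi i then u μ.1 else 0) =
      ∑ s ∈ Fintype.piFinset fun i => Finset.Icc (lo i) (hi i),
        ∑' b : ℕ, u (Fin.cons (c + b) s) := by
  set S := Fintype.piFinset fun i => Finset.Icc (lo i) (hi i) with hS
  have hmem : ∀ s, s ∈ S ↔ ∀ i, lo i ≤ s i ∧ s i ≤ hi i := by intro s; simp [hS]
  have hanti : ∀ (b : ℕ) (s : S), Antitone (Fin.cons (c + b) s.1 : Fin (q + 1) → ℕ) := by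
    intro b s i j hij
    have hs := (hmem s.1).1 s.2
    rcases hij.eq_or_lt with rfl | hij
    · exact le_rfl
    · cases j using Fin.cases with
      | zero => exact absurd hij (Fin.not_lt_zero _)
      | succ j =>
        cases i using Fin.cases with
        | zero => simpa using ((hs j).2.trans (hc j)).trans (Nat.le_add_right _ _)
        | succ i =>
          have hij' : i < j := Fin.succ_lt_succ_iff.1 hij
          simpa using ((hs j).2.trans (h i j hij')).trans (hs i).1
  let e : S × ℕ → RowPartition (q + 1) := fun p => ⟨Fin.cons (c + p.2) p.1.1, hanti p.2 p.1⟩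
  have he : Function.Injective e := by
    rintro ⟨s, b⟩ ⟨s', b'⟩ hh
    have h1 := congrArg Subtype.val hh
    simp only [e, Fin.cons_inj] at h1
    ext1
    · exact Subtype.ext h1.2
    · simpa using h1.1
  have hval : ∀ p : S × ℕ, (if c ≤ (e p).1 0 ∧
      ∀ i, lo i ≤ (e p).1 i.succ ∧ (e p).1 i.succ ≤ hi i then u (e p).1 else 0) =
      u (Fin.cons (c + p.2) p.1.1) := by
    intro p
    refine if_pos ⟨by simp [e], ?_⟩
    simpa [e] using (hmem p.1.1).1 p.1.2
  rw [← he.tsum_eq]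
  · have h2 := (hu.comp_injective he)
    simp only [Function.comp_def, hval] at h2
    simp only [hval]
    rw [h2.tsum_prod' (fun s => h2.comp_injective (i := fun b => (s, b))
      (fun a b hab => by simpa using hab)), tsum_fintype, Finset.sum_coe_sort S
        (fun s => ∑' b : ℕ, u (Fin.cons (c + b) s))]
  · intro μ hμ
    have hh : c ≤ μ.1 0 ∧ ∀ i, lo i ≤ μ.1 i.succ ∧ μ.1 i.succ ≤ hi i := by
      by_contra hcn
      exact hμ (if_neg hcn)
    refine ⟨(⟨Fin.tail μ.1, (hmem _).2 hh.2⟩, μ.1 0 - c), Subtype.ext ?_⟩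
    simp only [e]
    rw [Nat.add_sub_cancel' hh.1, Fin.cons_self_tail]

/-! ### Alternants: bounds, and branching in one variable. -/

/-- The alternant `det (z_i ^ (μ_j + q - 1 - j))`. -/
noncomputable def alternant {q : ℕ} (μ : Fin q → ℕ) (z : Fin q → ℂ) : ℂ :=
  Matrix.det (Matrix.of fun j i => z i ^ (μ j + (Fin.rev j : ℕ)))

theorem alternant_eq_sum {q : ℕ} (μ : Fin q → ℕ) (z : Fin q → ℂ) :
    alternant μ z = ∑ σ : Equiv.Perm (Fin q), ((Equiv.Perm.sign σ : ℤ) : ℂ) *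
      ∏ i, z i ^ (μ (σ i) + (Fin.rev (σ i) : ℕ)) := by
  simp [alternant, Matrix.det_apply']

/-- Each of the `q!` monomials of the Leibniz expansion has the same total degree, `|μ|` plus the
degree of the Vandermonde determinant. -/
theorem norm_alternant_le {q : ℕ} (μ : Fin q → ℕ) (z : Fin q → ℂ) {r : ℝ}
    (hz : ∀ i, ‖z i‖ ≤ r) :
    ‖alternant μ z‖ ≤ (q.factorial * r ^ ∑ i : Fin q, (Fin.rev i : ℕ)) * r ^ ∑ i, μ i := by
  rw [alternant_eq_sum]
  have : ∀ σ : Equiv.Perm (Fin q), ‖((Equiv.Perm.sign σ : ℤ) : ℂ) *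
      ∏ i, z i ^ (μ (σ i) + (Fin.rev (σ i) : ℕ))‖ ≤
      r ^ (∑ i : Fin q, (Fin.rev i : ℕ)) * r ^ ∑ i, μ i := by
    intro σ
    have h1 : ‖((Equiv.Perm.sign σ : ℤ) : ℂ)‖ = 1 := by
      rcases Int.units_eq_one_or (Equiv.Perm.sign σ) with h | h <;> simp [h]
    rw [norm_mul, h1, one_mul, norm_prod, ← pow_add, ← Finset.sum_add_distrib]
    calc ∏ i, ‖z i ^ (μ (σ i) + (Fin.rev (σ i) : ℕ))‖
        ≤ ∏ i, r ^ (μ (σ i) + (Fin.rev (σ i) : ℕ)) := by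
          refine Finset.prod_le_prod (fun _ _ => norm_nonneg _) fun i _ => ?_
          rw [norm_pow]
          exact pow_le_pow_left₀ (norm_nonneg _) (hz i) _
      _ = r ^ ∑ i, (μ (σ i) + (Fin.rev (σ i) : ℕ)) := by rw [Finset.prod_pow_eq_pow_sum]
      _ = r ^ ∑ i, ((Fin.rev i : ℕ) + μ i) := by
          rw [Equiv.sum_comp σ fun i => μ i + (Fin.rev i : ℕ)]
          simp only [add_comm]
  refine (norm_sum_le_of_le _ fun σ _ => this σ).trans ?_
  simp [Fintype.card_perm, mul_assoc]

theorem alternant_smul {q : ℕ} (μ : Fin q → ℕ) (t : ℂ) (y : Fin q → ℂ) :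
    alternant μ (fun i => t * y i) =
      t ^ (∑ i : Fin q, (Fin.rev i : ℕ)) * (t ^ (∑ i, μ i) * alternant μ y) := by
  simp only [alternant_eq_sum, Finset.mul_sum]
  refine Finset.sum_congr rfl fun σ _ => ?_
  have : t ^ (∑ i : Fin q, (Fin.rev i : ℕ)) * t ^ (∑ i, μ i) =
      ∏ i, t ^ (μ (σ i) + (Fin.rev (σ i) : ℕ)) := by
    rw [Finset.prod_pow_eq_pow_sum, Equiv.sum_comp σ fun i => μ i + (Fin.rev i : ℕ),
      Finset.sum_add_distrib, ← pow_add, add_comm]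
  simp only [mul_pow, Finset.prod_mul_distrib]
  rw [← this]; ring

theorem det_sum_rows {q : ℕ} (S : Fin q → Finset ℕ) (c : Fin q → ℕ → ℂ)
    (v : Fin q → ℕ → Fin q → ℂ) :
    Matrix.det (Matrix.of fun j i => ∑ b ∈ S j, c j b * v j b i) =
      ∑ s ∈ Fintype.piFinset S, (∏ j, c j (s j)) * Matrix.det (Matrix.of fun j i => v j (s j) i) := by
  have h1 : (Matrix.of fun j i => ∑ b ∈ S j, c j b * v j b i) =
      fun j => ∑ b ∈ S j, c j b • v j b := by
    ext j i
    simp [Finset.sum_apply]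
  rw [h1]
  have := (Matrix.detRowAlternating (n := Fin q) (R := ℂ)).toMultilinearMap.map_sum_finset
    (fun j b => c j b • v j b) S
  refine this.trans (Finset.sum_congr rfl fun s _ => ?_)
  have := (Matrix.detRowAlternating (n := Fin q) (R := ℂ)).toMultilinearMap.map_smul_univ
    (fun j => c j (s j)) (fun j => v j (s j))
  exact this

/-- Reversing both rows and columns turns row operations with the next row into row operations with
the previous one. -/
theorem det_eq_of_forall_row_eq_smul_add_next {n : ℕ}
    {A B : Matrix (Fin (n + 1)) (Fin (n + 1)) ℂ} (c : Fin n → ℂ)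
    (A_last : ∀ j, A (Fin.last n) j = B (Fin.last n) j)
    (A_castSucc : ∀ (i : Fin n) (j), A i.castSucc j = B i.castSucc j + c i * A i.succ j) :
    A.det = B.det := by
  rw [← Matrix.det_submatrix_equiv_self Fin.revPerm A,
    ← Matrix.det_submatrix_equiv_self Fin.revPerm B]
  have h := Matrix.det_eq_of_forall_row_eq_smul_add_pred
    (A := A.submatrix (Fin.revPerm) (Fin.revPerm)) (B := B.submatrix (Fin.revPerm) (Fin.revPerm))
    (fun i => c i.rev) ?_ ?_
  · exact h
  · intro j
    simp [A_last]
  · intro i j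
    simp only [Matrix.submatrix_apply, Fin.revPerm_apply, Fin.rev_succ, Fin.rev_castSucc]
    exact A_castSucc _ _

theorem sum_sub_pow_eq {q : ℕ} {f g : Fin q → ℕ} (h : ∀ i, f i ≤ g i) (x : ℂ) :
    ∏ i, x ^ (g i - f i) = x ^ ((∑ i, g i) - ∑ i, f i) := by
  rw [Finset.prod_pow_eq_pow_sum, Finset.sum_tsub_distrib _ fun i _ => h i]

theorem sub_mul_sum_Icc_pow (x z : ℂ) {a b : ℕ} (h : a ≤ b) (c : ℕ) :
    (x - z) * ∑ s ∈ Finset.Icc a b, x ^ (b - s) * z ^ (s + c) =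
      x ^ (b - a + 1) * z ^ (a + c) - z ^ (b + c + 1) := by
  induction b, h using Nat.le_induction with
  | base => simp; ring
  | succ b hb ih =>
    rw [← Finset.insert_Icc_right_eq_Icc_add_one (by omega), Finset.sum_insert (by simp)]
    have : ∑ s ∈ Finset.Icc a b, x ^ (b + 1 - s) * z ^ (s + c) =
        x * ∑ s ∈ Finset.Icc a b, x ^ (b - s) * z ^ (s + c) := by
      rw [Finset.mul_sum]
      refine Finset.sum_congr rfl fun s hs => ?_
      rw [Nat.sub_add_comm (Finset.mem_Icc.1 hs).2, pow_succ]; ring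
    rw [this, mul_add, mul_left_comm (x - z) x, ih, Nat.sub_add_comm hb]
    simp only [Nat.sub_self]
    ring

/-- Branching of alternants. -/
theorem alternant_cons {q : ℕ} {κ : Fin (q + 1) → ℕ} (hκ : Antitone κ) (x : ℂ) (z : Fin q → ℂ) :
    alternant κ (Fin.cons x z) = (∏ i, (x - z i)) *
      ∑ s ∈ Fintype.piFinset fun i : Fin q => Finset.Icc (κ i.succ) (κ i.castSucc),
        x ^ ((∑ i, κ i) - ∑ i, s i) * alternant s z := by
  have hle : ∀ i : Fin q, κ i.succ ≤ κ i.castSucc := fun i => hκ (Fin.castSucc_lt_succ).le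
  let w : Fin (q + 1) → ℂ := Fin.cons x z
  -- From each row a multiple of the next one is subtracted, with the power of `x` chosen so that
  -- the column of the variable `x` vanishes except in its last entry.
  let B : Matrix (Fin (q + 1)) (Fin (q + 1)) ℂ := Matrix.of fun j i =>
    Fin.lastCases (w i ^ κ (Fin.last q))
      (fun j : Fin q => w i ^ (κ j.castSucc + (Fin.rev j : ℕ) + 1) -
        x ^ (κ j.castSucc - κ j.succ + 1) * w i ^ (κ j.succ + (Fin.rev j : ℕ))) j
  have hAB : alternant κ w = B.det := by
    refine det_eq_of_forall_row_eq_smul_add_next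
      (fun j => x ^ (κ j.castSucc - κ j.succ + 1)) ?_ ?_
    · intro i
      simp [B]
    · intro j i
      simp only [B, Matrix.of_apply, Fin.lastCases_castSucc, Fin.rev_castSucc, Fin.rev_succ,
        Fin.val_succ, Fin.val_castSucc]
      ring
  have hB0 : ∀ j : Fin q, B j.castSucc 0 = 0 := by
    intro j
    simp only [B, w, Matrix.of_apply, Fin.lastCases_castSucc, Fin.cons_zero, ← pow_add]
    rw [sub_eq_zero]
    congr 1
    have := hle j
    omega
  have hsub : (B.submatrix (Fin.last q).succAbove Fin.succ) = Matrix.of fun j i =>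
      (-(x - z i)) * (Matrix.of fun j i => ∑ b ∈ Finset.Icc (κ j.succ) (κ j.castSucc),
        x ^ (κ j.castSucc - b) * z i ^ (b + (Fin.rev j : ℕ))) j i := by
    ext j i
    simp only [Matrix.submatrix_apply, Fin.succAbove_last, Matrix.of_apply, neg_mul,
      sub_mul_sum_Icc_pow x (z i) (hle j), B, w, Fin.lastCases_castSucc, Fin.cons_succ]
    ring
  rw [show alternant κ (Fin.cons x z) = alternant κ w from rfl, hAB, Matrix.det_succ_column_zero,
    Fin.sum_univ_castSucc]
  simp only [hB0, mul_zero, zero_mul, Finset.sum_const_zero, zero_add]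
  rw [hsub, Matrix.det_mul_row, Finset.prod_neg,
    det_sum_rows (fun j : Fin q => Finset.Icc (κ j.succ) (κ j.castSucc))
      (fun j b => x ^ (κ j.castSucc - b)) (fun j b i => z i ^ (b + (Fin.rev j : ℕ)))]
  -- One sign `(-1)^q` comes from expanding along the first column at the last row, the other from
  -- writing the `q` factors `z_i - x` as `-(x - z_i)`.
  have hsign : ((-1 : ℂ) ^ q) * (-1) ^ q = 1 := by rw [← mul_pow]; simp
  have hlast : B (Fin.last q) 0 = x ^ κ (Fin.last q) := by simp [B, w]
  rw [hlast]
  simp only [Fin.val_last, Finset.card_univ, Fintype.card_fin]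
  rw [show ∀ a b c : ℂ, (-1) ^ q * a * ((-1) ^ q * b * c) = ((-1 : ℂ) ^ q * (-1) ^ q) *
    (b * (a * c)) by intros; ring, hsign, one_mul, Finset.mul_sum]
  congr 1
  refine Finset.sum_congr rfl fun s hs => ?_
  simp only [Fintype.mem_piFinset, Finset.mem_Icc] at hs
  rw [sum_sub_pow_eq fun i => (hs i).2, ← mul_assoc, ← pow_add]
  congr 2
  have := Finset.sum_le_sum fun (i : Fin q) (_ : i ∈ Finset.univ) => (hs i).2
  rw [Fin.sum_univ_castSucc]
  omega

/-- The square leaves room to spare: `(ρ^2)^|κ|` splits as `ρ^|κ| ρ^|κ|`, and one factor pays for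
the summation over a second partition contained in `κ`. -/
theorem exists_common_bound {q : ℕ} (w : Fin q → ℂ) (hw : ∀ i, ‖w i‖ < 1) :
    ∃ ρ : ℝ, 0 < ρ ∧ ρ < 1 ∧ ∀ i, ‖w i‖ ≤ ρ ^ 2 := by
  have : ∀ᶠ ρ : ℝ in nhdsWithin 1 (Set.Iio 1), 0 < ρ ∧ ρ < 1 ∧ ∀ i, ‖w i‖ ≤ ρ ^ 2 := by
    refine (eventually_nhdsWithin_of_eventually_nhds (lt_mem_nhds one_pos)).and
      (eventually_mem_nhdsWithin.and (Filter.eventually_all.2 fun i => ?_))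
    refine eventually_nhdsWithin_of_eventually_nhds ?_
    have hc : Filter.Tendsto (fun ρ : ℝ => ρ ^ 2) (nhds 1) (nhds (1 ^ 2)) :=
      (continuous_pow 2).tendsto 1
    filter_upwards [hc.eventually (lt_mem_nhds (show ‖w i‖ < 1 ^ 2 by simpa using hw i))]
      with ρ h using h.le
  exact this.exists

theorem summable_rowPartition_of_norm_le {q : ℕ} {f : RowPartition q → ℂ} (C : ℝ) {r : ℝ}
    (h0 : 0 ≤ r) (h1 : r < 1) (h : ∀ μ, ‖f μ‖ ≤ C * r ^ μ.size) : Summable f :=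
  Summable.of_norm_bounded ((summable_pow_size q h0 h1).mul_left C) h

theorem summable_rowPartition_prod_of_norm_le {p q : ℕ} {f : RowPartition p × RowPartition q → ℂ}
    (C : ℝ) {r : ℝ} (h0 : 0 ≤ r) (h1 : r < 1)
    (h : ∀ κ μ, ‖f (κ, μ)‖ ≤ C * (r ^ κ.size * r ^ μ.size)) : Summable f :=
  Summable.of_norm_bounded (((summable_pow_size p h0 h1).mul_of_nonneg
    (summable_pow_size q h0 h1) (fun _ => pow_nonneg h0 _) fun _ => pow_nonneg h0 _).mul_left C)
    fun x => h x.1 x.2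

theorem pow_sq_le_mul_pow {r : ℝ} (h0 : 0 ≤ r) (h1 : r ≤ 1) {a b : ℕ} (h : b ≤ a) :
    (r ^ 2) ^ a ≤ r ^ a * r ^ b := by
  rw [← pow_mul, ← pow_add]
  exact pow_le_pow_of_le_one h0 h1 (by omega)

/-- Summed branching of alternants. -/
theorem tsum_alternant_cons {q : ℕ} (g : RowPartition (q + 1) → ℂ) (C : ℝ) (hg : ∀ κ, ‖g κ‖ ≤ C)
    (x : ℂ) (hx : ‖x‖ < 1) (z : Fin q → ℂ) (hz : ∀ i, ‖z i‖ < 1) :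
    ∑' κ : RowPartition (q + 1), g κ * alternant κ.1 (Fin.cons x z) = (∏ i, (x - z i)) *
      ∑' lam : RowPartition q, (∑' κ : RowPartition (q + 1),
        if Interlaces κ.1 lam.1 then x ^ (κ.size - lam.size) * g κ else 0) * alternant lam.1 z := by
  obtain ⟨ρ, h0, h1, hρ⟩ := exists_common_bound (Fin.cons x z : Fin (q + 1) → ℂ)
    (fun i => by cases i using Fin.cases <;> simp [hx, hz])
  have hxρ : ‖x‖ ≤ ρ ^ 2 := by simpa using hρ 0
  have hzρ : ∀ i, ‖z i‖ ≤ ρ ^ 2 := fun i => by simpa using hρ i.succ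
  set K := (q.factorial * (ρ ^ 2) ^ ∑ i : Fin q, (Fin.rev i : ℕ))
  let F : RowPartition (q + 1) × RowPartition q → ℂ := fun p =>
    if Interlaces p.1.1 p.2.1 then
      g p.1 * (x ^ (p.1.size - p.2.size) * alternant p.2.1 z) else 0
  have hC : 0 ≤ C := (norm_nonneg _).trans (hg ⟨0, fun _ _ _ => le_rfl⟩)
  have hK : 0 ≤ K := by positivity
  have hF : Summable F := by
    refine summable_rowPartition_prod_of_norm_le (C * K) h0.le h1 fun κ μ => ?_
    simp only [F]
    split_ifs with h
    · have hle : μ.size ≤ κ.size := h.sum_le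
      rw [norm_mul, norm_mul, norm_pow, mul_assoc]
      refine mul_le_mul (hg κ) ?_ (by positivity) hC
      calc ‖x‖ ^ (κ.size - μ.size) * ‖alternant μ.1 z‖
          ≤ (ρ ^ 2) ^ (κ.size - μ.size) * (K * (ρ ^ 2) ^ μ.size) :=
            mul_le_mul (pow_le_pow_left₀ (norm_nonneg _) hxρ _) (norm_alternant_le μ.1 z hzρ)
              (norm_nonneg _) (by positivity)
        _ = K * (ρ ^ 2) ^ κ.size := by
            rw [mul_left_comm, ← pow_add, Nat.sub_add_cancel hle]
        _ ≤ _ := mul_le_mul_of_nonneg_left (pow_sq_le_mul_pow h0.le h1.le hle) hK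
    · rw [norm_zero]; positivity
  have h1 : ∀ κ : RowPartition (q + 1), g κ * alternant κ.1 (Fin.cons x z) =
      (∏ i, (x - z i)) * ∑' lam, F (κ, lam) := by
    intro κ
    have hb := tsum_rowPartition_of_box (fun i : Fin q => κ.1 i.succ) (fun i => κ.1 i.castSucc)
      (fun i j hij => κ.2 (by simp only [Fin.le_def, Fin.val_succ, Fin.val_castSucc]; exact hij))
      (fun s => g κ * (x ^ (κ.size - ∑ i, s i) * alternant s z))
    rw [alternant_cons κ.2, mul_left_comm, Finset.mul_sum]
    congr 1
    exact hb.symm.trans (tsum_congr fun lam => if_congr Iff.rfl rfl rfl)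
  simp_rw [h1]
  rw [tsum_mul_left]
  congr 1
  refine (Summable.tsum_comm (f := fun κ lam => F (κ, lam)) hF).symm.trans ?_
  refine tsum_congr fun lam => ?_
  rw [← tsum_mul_right]
  refine tsum_congr fun κ => ?_
  simp only [F]
  split_ifs <;> ring

/-! ### The Pieri rule. -/

theorem one_sub_mul_sum_Icc_pow (x z : ℂ) {a b : ℕ} (h : a ≤ b) (c : ℕ) :
    (1 - x * z) * ∑ s ∈ Finset.Icc a b, x ^ (s - a) * z ^ (s + c) =
      z ^ (a + c) - x ^ (b - a + 1) * z ^ (b + c + 1) := by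
  induction b, h using Nat.le_induction with
  | base => simp; ring
  | succ b hb ih =>
    rw [← Finset.insert_Icc_right_eq_Icc_add_one (by omega), Finset.sum_insert (by simp),
      mul_add, ih, Nat.sub_add_comm hb]
    ring

theorem one_sub_mul_ne_zero {x z : ℂ} (hx : ‖x‖ < 1) (hz : ‖z‖ < 1) : 1 - x * z ≠ 0 := by
  intro h
  have : ‖x * z‖ = 1 := by rw [← sub_eq_zero.1 h]; simp
  rw [norm_mul] at this
  nlinarith [norm_nonneg x, norm_nonneg z]

theorem one_sub_ne_zero_of_norm_lt {x : ℂ} (hx : ‖x‖ < 1) : 1 - x ≠ 0 := by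
  intro h
  rw [← sub_eq_zero.1 h] at hx
  simp at hx

/-- By Laplace expansion along the first row, the determinant is a finite linear combination of the
entries of that row. -/
theorem hasSum_det_cons {q : ℕ} {f : ℕ → Fin (q + 1) → ℂ} {v : Fin (q + 1) → ℂ}
    (h : HasSum f v) (R : Fin q → Fin (q + 1) → ℂ) :
    HasSum (fun b => Matrix.det (Matrix.of (Fin.cons (f b) R : Fin (q + 1) → Fin (q + 1) → ℂ)))
      (Matrix.det (Matrix.of (Fin.cons v R : Fin (q + 1) → Fin (q + 1) → ℂ))) := by
  have hsub : ∀ (u : Fin (q + 1) → ℂ) (j : Fin (q + 1)),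
      (Matrix.of (Fin.cons u R : Fin (q + 1) → Fin (q + 1) → ℂ)).submatrix Fin.succ j.succAbove =
        Matrix.of fun i k => R i (j.succAbove k) := by
    intro u j
    ext i k
    simp
  simp only [Matrix.det_succ_row_zero, hsub, Matrix.of_apply, Fin.cons_zero]
  exact hasSum_sum fun j _ => ((Pi.hasSum.1 h j).mul_left _).mul_right _

theorem det_cons_sum_rows {q : ℕ} (u : Fin (q + 1) → ℂ) (S : Fin q → Finset ℕ)
    (c : Fin q → ℕ → ℂ) (v : Fin q → ℕ → Fin (q + 1) → ℂ) :
    Matrix.det (Matrix.of (Fin.cons u fun j i => ∑ b ∈ S j, c j b * v j b i :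
        Fin (q + 1) → Fin (q + 1) → ℂ)) =
      ∑ s ∈ Fintype.piFinset S, (∏ j, c j (s j)) *
        Matrix.det (Matrix.of (Fin.cons u fun j => v j (s j) : Fin (q + 1) → Fin (q + 1) → ℂ)) := by
  let D := (Matrix.detRowAlternating (n := Fin (q + 1)) (R := ℂ)).toMultilinearMap.curryLeft u
  have h1 : (fun j i => ∑ b ∈ S j, c j b * v j b i : Fin q → Fin (q + 1) → ℂ) =
      fun j => ∑ b ∈ S j, c j b • v j b := by
    ext j i
    simp [Finset.sum_apply]
  rw [h1]
  refine (D.map_sum_finset (fun j b => c j b • v j b) S).trans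
    (Finset.sum_congr rfl fun s _ => ?_)
  exact D.map_smul_univ (fun j => c j (s j)) (fun j => v j (s j))

theorem det_cons_smul {q : ℕ} (a : ℂ) (u : Fin (q + 1) → ℂ) (R : Fin q → Fin (q + 1) → ℂ) :
    Matrix.det (Matrix.of (Fin.cons (a • u) R : Fin (q + 1) → Fin (q + 1) → ℂ)) =
      a * Matrix.det (Matrix.of (Fin.cons u R : Fin (q + 1) → Fin (q + 1) → ℂ)) := by
  let D := (Matrix.detRowAlternating (n := Fin (q + 1)) (R := ℂ)).toMultilinearMap.curryLeft
  exact congrArg (fun E => E R) (D.map_smul a u)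

/-- The Pieri rule for multiplication of an alternant by the generating function of complete
homogeneous symmetric polynomials. -/
theorem tsum_isHorizontalStrip_alternant {q : ℕ} (μ : RowPartition (q + 1)) (x : ℂ) (hx : ‖x‖ < 1)
    (z : Fin (q + 1) → ℂ) (hz : ∀ i, ‖z i‖ < 1) :
    ∑' lam : RowPartition (q + 1), (if IsHorizontalStrip lam.1 μ.1 then
      x ^ (lam.size - μ.size) * alternant lam.1 z else 0) =
      (∏ i, 1 / (1 - x * z i)) * alternant μ.1 z := by
  obtain ⟨ρ, h0, h1, hρ⟩ := exists_common_bound z hz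
  have hle : ∀ i : Fin q, μ.1 i.succ ≤ μ.1 i.castSucc := fun i => μ.2 (Fin.castSucc_lt_succ).le
  have hne : ∀ i, 1 - x * z i ≠ 0 := fun i => one_sub_mul_ne_zero hx (hz i)
  have hcone := tsum_rowPartition_of_cone (μ.1 0) (fun i : Fin q => μ.1 i.succ)
      (fun i => μ.1 i.castSucc)
      (fun i j hij => μ.2 (by simp only [Fin.le_def, Fin.val_succ, Fin.val_castSucc]; exact hij))
      (fun i => μ.2 (Fin.zero_le _))
      (fun s => x ^ ((∑ i, s i) - μ.size) * alternant s z)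
      (summable_rowPartition_of_norm_le
        ((q + 1).factorial * (ρ ^ 2) ^ ∑ i : Fin (q + 1), (Fin.rev i : ℕ))
        (by positivity : 0 ≤ ρ ^ 2) (by nlinarith) (fun lam => by
          split_ifs with h
          · rw [norm_mul, norm_pow]
            refine (mul_le_of_le_one_left (norm_nonneg _)
              (pow_le_one₀ (norm_nonneg _) hx.le)).trans (norm_alternant_le lam.1 z hρ)
          · rw [norm_zero]; positivity))
  refine (tsum_congr fun lam => if_congr Iff.rfl rfl rfl).trans (hcone.trans ?_)
  let R : Fin q → Fin (q + 1) → ℂ := fun j i => ∑ b ∈ Finset.Icc (μ.1 j.succ) (μ.1 j.castSucc),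
    x ^ (b - μ.1 j.succ) * z i ^ (b + (Fin.rev j.succ : ℕ))
  let r0 : ℕ → Fin (q + 1) → ℂ := fun b i => z i ^ (μ.1 0 + b + q)
  have hr0 : HasSum (fun b => x ^ b • r0 b) (fun i => 1 / (1 - x * z i) * z i ^ (μ.1 0 + q)) := by
    rw [Pi.hasSum]
    intro i
    have := (hasSum_geometric_of_norm_lt_one (ξ := x * z i) (by
      rw [norm_mul]; nlinarith [norm_nonneg x, norm_nonneg (z i), hz i])).mul_right
        (z i ^ (μ.1 0 + q))
    rw [one_div]
    refine this.congr_fun ?_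
    intro b
    simp only [Pi.smul_apply, smul_eq_mul, r0]
    ring
  -- After column `i` is scaled by `1 / (1 - x z_i)`, a multiple of the previous row is subtracted
  -- from every row but the first. This truncates their geometric series to the finite intervals
  -- allowed by a horizontal strip; the first row keeps the full series, since the first part is
  -- unbounded.
  let B : Matrix (Fin (q + 1)) (Fin (q + 1)) ℂ := Matrix.of (Fin.cons
    (fun i => 1 / (1 - x * z i) * z i ^ (μ.1 0 + q)) R)
  have hdetB : (∏ i, 1 / (1 - x * z i)) * alternant μ.1 z = B.det := by
    rw [alternant, ← Matrix.det_mul_row]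
    refine Matrix.det_eq_of_forall_row_eq_smul_add_pred
      (fun j => x ^ (μ.1 j.castSucc - μ.1 j.succ + 1)) ?_ ?_
    · intro i
      simp [B]
    · intro j i
      have := one_sub_mul_sum_Icc_pow x (z i) (hle j) (Fin.rev j.succ : ℕ)
      simp only [B, R, Matrix.of_apply, Fin.cons_succ, Fin.rev_castSucc, Fin.rev_succ,
        Fin.val_succ, Fin.val_castSucc] at this ⊢
      have h3 := hne i
      field_simp
      linear_combination -this
  rw [hdetB, det_cons_sum_rows _ (fun j : Fin q => Finset.Icc (μ.1 j.succ) (μ.1 j.castSucc))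
    (fun j b => x ^ (b - μ.1 j.succ)) (fun j b i => z i ^ (b + (Fin.rev j.succ : ℕ)))]
  refine Finset.sum_congr rfl fun s hs => ?_
  simp only [Fintype.mem_piFinset, Finset.mem_Icc] at hs
  rw [← (hasSum_det_cons hr0 _).tsum_eq, ← tsum_mul_left]
  refine tsum_congr fun b => ?_
  have h4 := Finset.sum_le_sum fun (i : Fin q) (_ : i ∈ Finset.univ) => (hs i).1
  rw [det_cons_smul, sum_sub_pow_eq fun i => (hs i).1, ← mul_assoc, ← pow_add]
  congr 2
  · simp only [RowPartition.size, Fin.sum_univ_succ, Fin.cons_zero, Fin.cons_succ]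
    omega
  · refine congrArg Matrix.det ?_
    ext j i
    cases j using Fin.cases with
    | zero => simp [r0]
    | succ j => simp

/-! ### Adding and removing horizontal strips, and Littlewood's identity. -/

theorem sum_Icc_pow_reflect (x : ℂ) (a b : ℕ) :
    ∑ s ∈ Finset.Icc a b, x ^ (s - a) = ∑ s ∈ Finset.Icc a b, x ^ (b - s) := by
  refine Finset.sum_nbij' (fun s => a + b - s) (fun s => a + b - s) ?_ ?_ ?_ ?_ ?_
  all_goals
    intro s hs
    rw [Finset.mem_Icc] at hs
  · rw [Finset.mem_Icc]; omega
  · rw [Finset.mem_Icc]; omega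
  · omega
  · omega
  · congr 1; omega

/-- The lower bounds `lam_{i+1}` of the parts of a partition obtained from `lam` by removing a
horizontal strip. -/
def nextParts {q : ℕ} (lam : Fin (q + 1) → ℕ) : Fin (q + 1) → ℕ :=
  Fin.snoc (α := fun _ => ℕ) (fun j : Fin q => lam j.succ) 0

theorem sum_eq_add_sum_nextParts {q : ℕ} (lam : Fin (q + 1) → ℕ) :
    ∑ i, lam i = lam 0 + ∑ i, nextParts lam i := by
  rw [Fin.sum_univ_succ, Fin.sum_univ_castSucc (nextParts lam)]
  simp [nextParts]

theorem le_nextParts {q : ℕ} (lam : RowPartition (q + 1)) (i j : Fin (q + 1)) (h : i < j) :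
    lam.1 j ≤ nextParts lam.1 i := by
  cases i using Fin.lastCases with
  | last => exact absurd (Fin.le_last j) (not_le.2 h)
  | cast i =>
    simp only [nextParts, Fin.snoc_castSucc]
    exact lam.2 (by simp only [Fin.le_def, Fin.lt_def, Fin.val_succ, Fin.val_castSucc] at h ⊢; omega)

/-- In this form every later part of `κ` ranges over the interval `[lam_{i+1}, lam_i]`, the same
interval as for the parts of a partition obtained from `lam` by removing a strip. Only the first
part of `κ` is extra. -/
theorem interlaces_iff_nextParts {q : ℕ} (κ : Fin (q + 2) → ℕ) (lam : Fin (q + 1) → ℕ) :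
    Interlaces κ lam ↔ lam 0 ≤ κ 0 ∧ ∀ i, nextParts lam i ≤ κ i.succ ∧ κ i.succ ≤ lam i := by
  constructor
  · intro h
    refine ⟨by simpa using (h 0).2, fun i => ⟨?_, (h i).1⟩⟩
    cases i using Fin.lastCases with
    | last => simp [nextParts]
    | cast i => simpa [nextParts] using (h i.succ).2
  · rintro ⟨h0, h⟩ i
    refine ⟨(h i).2, ?_⟩
    cases i using Fin.cases with
    | zero => simpa using h0
    | succ i => simpa [nextParts] using (h i.castSucc).1

theorem isHorizontalStrip_iff_nextParts {q : ℕ} (lam μ : Fin (q + 1) → ℕ) :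
    IsHorizontalStrip lam μ ↔ ∀ i, nextParts lam i ≤ μ i ∧ μ i ≤ lam i := by
  constructor
  · intro h i
    refine ⟨?_, h.le i⟩
    cases i using Fin.lastCases with
    | last => simp [nextParts]
    | cast i => simpa [nextParts] using (h.2 i).2
  · intro h
    refine ⟨(h 0).2, fun i => ⟨(h _).2, ?_⟩⟩
    simpa [nextParts] using (h i.castSucc).1

/-- The strictly positive `r` replaces `x`, which may vanish and then cannot be divided by. -/
theorem pow_sub_le_div {x r : ℝ} (h0 : 0 ≤ x) (hx : x ≤ r) (hr : 0 < r) {a b : ℕ} (h : b ≤ a) :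
    x ^ (a - b) ≤ (r ^ b)⁻¹ * r ^ a := by
  rw [mul_comm, ← pow_sub₀ r hr.ne' h]
  exact pow_le_pow_left₀ h0 hx _

theorem summable_interlaces_pow {q : ℕ} (lam : RowPartition q) (x : ℂ) (hx : ‖x‖ < 1)
    (g : RowPartition (q + 1) → ℂ) (C : ℝ) (hg : ∀ κ, ‖g κ‖ ≤ C) :
    Summable fun κ : RowPartition (q + 1) =>
      if Interlaces κ.1 lam.1 then x ^ (κ.size - lam.size) * g κ else 0 := by
  obtain ⟨r, hr, h1⟩ := exists_between hx
  have h0 : 0 < r := (norm_nonneg x).trans_lt hr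
  have hC : 0 ≤ C := (norm_nonneg _).trans (hg ⟨0, fun _ _ _ => le_rfl⟩)
  refine summable_rowPartition_of_norm_le (C * (r ^ lam.size)⁻¹) h0.le h1 fun κ => ?_
  split_ifs with h
  · rw [norm_mul, norm_pow, mul_comm, mul_assoc]
    exact mul_le_mul (hg κ) (pow_sub_le_div (norm_nonneg x) hr.le h0 h.sum_le)
      (by positivity) hC
  · rw [norm_zero]; positivity

/-- Adding horizontal strips versus removing horizontal strips. -/
theorem tsum_interlaces_pow {q : ℕ} (lam : RowPartition (q + 1)) (x : ℂ) (hx : ‖x‖ < 1) :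
    ∑' κ : RowPartition (q + 2), (if Interlaces κ.1 lam.1 then x ^ (κ.size - lam.size) else 0) =
      1 / (1 - x) * ∑' μ : RowPartition (q + 1),
        if IsHorizontalStrip lam.1 μ.1 then x ^ (lam.size - μ.size) else 0 := by
  have hs := summable_interlaces_pow lam x hx (fun _ => 1) 1 (by simp)
  simp only [mul_one, interlaces_iff_nextParts] at hs
  simp only [interlaces_iff_nextParts, isHorizontalStrip_iff_nextParts]
  have h1 := tsum_rowPartition_of_cone (lam.1 0) (nextParts lam.1) lam.1 (le_nextParts lam)
    (fun i => lam.2 (Fin.zero_le _)) (fun s => x ^ ((∑ i, s i) - lam.size)) hs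
  have h2 := tsum_rowPartition_of_box (nextParts lam.1) lam.1 (le_nextParts lam)
    (fun s => x ^ (lam.size - ∑ i, s i))
  refine h1.trans ((congrArg _ h2).trans ?_).symm
  have hA : ∑ s ∈ Fintype.piFinset fun i => Finset.Icc (nextParts lam.1 i) (lam.1 i),
      x ^ (lam.size - ∑ i, s i) = ∏ i, ∑ b ∈ Finset.Icc (nextParts lam.1 i) (lam.1 i),
        x ^ (lam.1 i - b) := by
    rw [Finset.prod_univ_sum]
    refine Finset.sum_congr rfl fun s hs => ?_
    simp only [Fintype.mem_piFinset, Finset.mem_Icc] at hs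
    rw [sum_sub_pow_eq fun i => (hs i).2]
    rfl
  rw [hA]
  -- Reflecting each interval exchanges the boxes removed with the boxes added.
  simp only [← sum_Icc_pow_reflect]
  rw [Finset.prod_univ_sum, Finset.mul_sum]
  refine Finset.sum_congr rfl fun s hs => ?_
  simp only [Fintype.mem_piFinset, Finset.mem_Icc] at hs
  -- The factor `1 / (1 - x)` is the geometric series of the excess `b` of the first part of `κ`
  -- over that of `lam`.
  rw [sum_sub_pow_eq fun i => (hs i).1, one_div, ← tsum_geometric_of_norm_lt_one hx,
    ← tsum_mul_right]
  refine tsum_congr fun b => ?_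
  rw [← pow_add]
  congr 1
  have := Finset.sum_le_sum fun (i : Fin (q + 1)) (_ : i ∈ Finset.univ) => (hs i).1
  rw [RowPartition.size, sum_eq_add_sum_nextParts lam.1, Fin.sum_cons]
  omega

/-- The product in Littlewood's identity. -/
noncomputable def littlewoodProd {q : ℕ} (z : Fin q → ℂ) : ℂ :=
  (∏ i, 1 / (1 - z i)) * ∏ i, ∏ j ∈ Finset.Ioi i, (z i - z j) / (1 - z i * z j)

theorem littlewoodProd_cons {q : ℕ} (x : ℂ) (z : Fin q → ℂ) :
    littlewoodProd (Fin.cons x z : Fin (q + 1) → ℂ) =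
      1 / (1 - x) * (∏ i, (x - z i)) * (∏ i, 1 / (1 - x * z i)) * littlewoodProd z := by
  simp only [littlewoodProd, Fin.prod_univ_succ, Fin.cons_zero, Fin.cons_succ,
    Fin.prod_Ioi_zero, Fin.prod_Ioi_succ, div_eq_mul_inv, Finset.prod_mul_distrib, one_mul]
  ring

/-- Littlewood's identity: the sum of all alternants. -/
theorem tsum_alternant (q : ℕ) (z : Fin (q + 1) → ℂ) (hz : ∀ i, ‖z i‖ < 1) :
    ∑' μ : RowPartition (q + 1), alternant μ.1 z = littlewoodProd z := by
  induction q with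
  | zero =>
    have hs : Summable fun μ : RowPartition 1 => alternant μ.1 z := by
      obtain ⟨ρ, h0, h1, hρ⟩ := exists_common_bound z hz
      exact summable_rowPartition_of_norm_le _ (by positivity : 0 ≤ ρ ^ 2) (by nlinarith)
        fun μ => norm_alternant_le μ.1 z hρ
    have h := tsum_rowPartition_of_cone (q := 0) 0 ![] ![] (fun i => i.elim0) (fun i => i.elim0)
      (fun s => alternant s z) (by simpa using hs)
    have ha : ∀ b : ℕ, ∀ s : Fin 0 → ℕ,
        alternant (Fin.cons (0 + b) s : Fin 1 → ℕ) z = z 0 ^ b := by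
      intro b s
      simp [alternant]
    simp only [ha] at h
    simp only [zero_le, IsEmpty.forall_iff, and_self, if_true] at h
    rw [h]
    simp [littlewoodProd, tsum_geometric_of_norm_lt_one (hz 0)]
  | succ q ih =>
    obtain ⟨x, z, rfl⟩ : ∃ x z', z = (Fin.cons x z' : Fin (q + 2) → ℂ) :=
      ⟨z 0, Fin.tail z, (Fin.cons_self_tail z).symm⟩
    have hx : ‖x‖ < 1 := by simpa using hz 0
    have hz : ∀ i, ‖z i‖ < 1 := fun i => by simpa using hz i.succ
    have h := tsum_alternant_cons (fun _ : RowPartition (q + 2) => (1 : ℂ)) 1 (by simp) x hx z hz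
    simp only [one_mul, mul_one] at h
    rw [h, littlewoodProd_cons, ← ih z hz]
    simp only [tsum_interlaces_pow _ x hx]
    obtain ⟨ρ, h0, h1, hρ⟩ := exists_common_bound z hz
    set K := ((q + 1).factorial * (ρ ^ 2) ^ ∑ i : Fin (q + 1), (Fin.rev i : ℕ))
    let F : RowPartition (q + 1) × RowPartition (q + 1) → ℂ := fun p =>
      if IsHorizontalStrip p.1.1 p.2.1 then x ^ (p.1.size - p.2.size) * alternant p.1.1 z else 0
    have hF : Summable F := by
      refine summable_rowPartition_prod_of_norm_le K h0.le h1 fun lam μ => ?_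
      simp only [F]
      split_ifs with hs
      · rw [norm_mul, norm_pow]
        refine (mul_le_of_le_one_left (norm_nonneg _)
              (pow_le_one₀ (norm_nonneg _) hx.le)).trans ((norm_alternant_le lam.1 z hρ).trans ?_)
        exact mul_le_mul_of_nonneg_left (pow_sq_le_mul_pow h0.le h1.le hs.sum_le) (by positivity)
      · rw [norm_zero]; positivity
    have h3 : ∀ lam : RowPartition (q + 1), (1 / (1 - x) * ∑' μ : RowPartition (q + 1),
        if IsHorizontalStrip lam.1 μ.1 then x ^ (lam.size - μ.size) else 0) * alternant lam.1 z =
        1 / (1 - x) * ∑' μ, F (lam, μ) := by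
      intro lam
      rw [mul_assoc, ← tsum_mul_right]
      congr 1
      refine tsum_congr fun μ => ?_
      simp only [F]
      split_ifs <;> ring
    simp only [h3]
    rw [tsum_mul_left, ← Summable.tsum_comm (f := fun lam μ => F (lam, μ)) hF]
    simp only [F, tsum_isHorizontalStrip_alternant _ x hx z hz]
    rw [tsum_mul_left]
    ring

/-! ### Skew tableaux and their branching by the smallest letter. -/

/-- The Young diagram of a partition with at most `q` parts. -/
def RowPartition.toYD {q : ℕ} (μ : RowPartition q) : YoungDiagram where
  cells := Finset.univ.biUnion fun i : Fin q => (Finset.range (μ.1 i)).image fun j => ((i : ℕ), j)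
  isLowerSet := by
    rintro ⟨a, b⟩ ⟨c, d⟩ h hc
    simp only [Finset.coe_biUnion, Finset.coe_univ, Set.mem_univ, Set.iUnion_true, Finset.coe_image,
      Finset.coe_range, Set.mem_iUnion, Set.mem_image, Set.mem_Iio, Prod.mk.injEq] at hc ⊢
    obtain ⟨i, j, hj, rfl, rfl⟩ := hc
    obtain ⟨h1, h2⟩ := Prod.mk_le_mk.1 h
    exact ⟨⟨c, h1.trans_lt i.2⟩, d, (h2.trans_lt hj).trans_le (μ.2 h1), rfl, rfl⟩

theorem RowPartition.mem_toYD {q : ℕ} (μ : RowPartition q) (c : ℕ × ℕ) :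
    c ∈ μ.toYD ↔ ∃ h : c.1 < q, c.2 < μ.1 ⟨c.1, h⟩ := by
  rw [← YoungDiagram.mem_cells]
  simp only [RowPartition.toYD, Finset.mem_biUnion, Finset.mem_univ, true_and, Finset.mem_image,
    Finset.mem_range]
  constructor
  · rintro ⟨i, j, hj, rfl⟩
    exact ⟨i.2, hj⟩
  · rintro ⟨h, h2⟩
    exact ⟨⟨c.1, h⟩, c.2, h2, rfl⟩

theorem RowPartition.mk_mem_toYD {q : ℕ} (μ : RowPartition q) (i : Fin q) (j : ℕ) :
    ((i : ℕ), j) ∈ μ.toYD ↔ j < μ.1 i := by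
  rw [RowPartition.mem_toYD]
  exact ⟨fun h => h.2, fun h => ⟨i.2, h⟩⟩

theorem RowPartition.card_toYD {q : ℕ} (μ : RowPartition q) : μ.toYD.card = μ.size := by
  refine (Finset.card_biUnion ?_).trans (Finset.sum_congr rfl fun i _ => ?_)
  · intro i _ j _ hij
    rw [Function.onFun, Finset.disjoint_left]
    intro c hc hc'
    simp only [Finset.mem_image, Finset.mem_range] at hc hc'
    obtain ⟨a, _, rfl⟩ := hc
    obtain ⟨b, _, h⟩ := hc'
    exact hij (Fin.ext (congrArg Prod.fst h).symm)
  · rw [Finset.card_image_of_injective _ (fun a b h => congrArg Prod.snd h), Finset.card_range]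

theorem RowPartition.toYD_injective {q : ℕ} :
    Function.Injective (RowPartition.toYD : RowPartition q → YoungDiagram) := by
  intro μ ν h
  ext i
  refine eq_of_forall_lt_iff fun j => ?_
  rw [← μ.mk_mem_toYD, ← ν.mk_mem_toYD, h]

/-- The first `q` row lengths of a Young diagram. -/
def RowPartition.ofYD (q : ℕ) (Y : YoungDiagram) : RowPartition q :=
  ⟨fun i => Y.rowLen i, fun _ _ h => Y.rowLen_anti _ _ h⟩

theorem RowPartition.toYD_ofYD {q : ℕ} {Y : YoungDiagram} (h : partLength Y ≤ q) :
    (RowPartition.ofYD q Y).toYD = Y := by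
  refine SetLike.ext fun c => ?_
  rw [RowPartition.mem_toYD]
  simp only [RowPartition.ofYD, ← YoungDiagram.mem_iff_lt_rowLen]
  refine ⟨fun h => h.2, fun hc => ⟨?_, hc⟩⟩
  have : (c.1, 0) ∈ Y := Y.up_left_mem le_rfl (Nat.zero_le c.2) hc
  exact (YoungDiagram.mem_iff_lt_colLen.1 this).trans_le h

theorem RowPartition.partLength_toYD_le {q : ℕ} (μ : RowPartition q) :
    partLength μ.toYD ≤ q := by
  by_contra h
  have : (q, 0) ∈ μ.toYD := YoungDiagram.mem_iff_lt_colLen.2 (not_le.1 h)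
  exact lt_irrefl _ ((μ.mem_toYD _).1 this).1

/-- The skew Schur function over an arbitrary commutative semiring. -/
noncomputable def skewSchurOver {R : Type*} [CommSemiring R] (lam mu : YoungDiagram) {l : ℕ}
    (x : Fin l → R) : R :=
  open Classical in ∑ T : SkewCell lam mu → Fin l with IsSkewSSYT T, ∏ c, x (T c)

theorem skewSchurOver_eq_zero {R : Type*} [CommSemiring R] {lam mu : YoungDiagram} {l : ℕ}
    (x : Fin l → R) (h : ¬ mu ≤ lam) : skewSchurOver lam mu x = 0 := by
  classical
  rw [skewSchurOver, Finset.filter_false_of_mem, Finset.sum_empty]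
  exact fun T _ hT => h hT.1

open Classical in
theorem skewSchurOver_fin_zero {R : Type*} [CommSemiring R] (lam mu : YoungDiagram)
    (x : Fin 0 → R) : skewSchurOver lam mu x = if lam = mu then 1 else 0 := by
  split_ifs with h
  · subst h
    have : IsEmpty (SkewCell lam lam) := ⟨fun c => by simpa using c.2⟩
    rw [skewSchurOver, Finset.filter_true_of_mem]
    · simp
    · exact fun T _ => ⟨le_rfl, fun c => isEmptyElim c, fun c => isEmptyElim c⟩
  · rw [skewSchurOver, Finset.filter_false_of_mem, Finset.sum_empty]
    intro T _ hT
    refine h (le_antisymm (fun c hc => ?_) hT.1)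
    by_contra hcm
    exact (T ⟨c, by simp [hc, hcm]⟩).elim0

/-- The comparison goes through the cell in the row of `c` and the column of `d`, which again lies
in the skew shape. -/
theorem IsSkewSSYT.mono {lam mu : YoungDiagram} {l : ℕ} {T : SkewCell lam mu → Fin l}
    (hT : IsSkewSSYT T) (c d : SkewCell lam mu) (h1 : c.1.1 ≤ d.1.1) (h2 : c.1.2 ≤ d.1.2) :
    T c ≤ T d := by
  have hd := d.2
  have hc := c.2
  simp only [Finset.mem_sdiff, YoungDiagram.mem_cells] at hc hd
  let e : SkewCell lam mu := ⟨(c.1.1, d.1.2), by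
    simp only [Finset.mem_sdiff, YoungDiagram.mem_cells]
    exact ⟨lam.up_left_mem h1 le_rfl hd.1, fun h => hc.2 (mu.up_left_mem le_rfl h2 h)⟩⟩
  have hce : T c ≤ T e := by
    rcases h2.eq_or_lt with h | h
    · exact le_of_eq (congrArg T (Subtype.ext (Prod.ext rfl h)))
    · exact hT.2.1 c e rfl h
  have hed : T e ≤ T d := by
    rcases h1.eq_or_lt with h | h
    · exact le_of_eq (congrArg T (Subtype.ext (Prod.ext h rfl)))
    · exact (hT.2.2 e d rfl h).le
  exact hce.trans hed

theorem Interlaces.toYD_le {q : ℕ} {κ : RowPartition (q + 1)} {μ : RowPartition q}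
    (h : Interlaces κ.1 μ.1) : μ.toYD ≤ κ.toYD := by
  intro c hc
  obtain ⟨h1, h2⟩ := (μ.mem_toYD c).1 hc
  exact (κ.mem_toYD c).2 ⟨h1.trans (Nat.lt_succ_self q), h2.trans_le (h ⟨c.1, h1⟩).2⟩

theorem Interlaces.mem_of_lt {q : ℕ} {κ : RowPartition (q + 1)} {μ : RowPartition q}
    (h : Interlaces κ.1 μ.1) {i i' j : ℕ} (hi : i < i') (hc : (i', j) ∈ κ.toYD) :
    (i, j) ∈ μ.toYD := by
  obtain ⟨h1, h2⟩ := (κ.mem_toYD _).1 hc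
  dsimp only at h1 h2
  have hq : i < q := by omega
  refine (μ.mem_toYD _).2 ⟨hq, ?_⟩
  refine (h2.trans_le ?_).trans_le (h ⟨i, hq⟩).1
  exact κ.2 (by simp only [Fin.le_def, Fin.val_succ]; omega)

/-- The partition `κ` is the region of `lam` consisting of `μ` and the boxes with entry zero. -/
def IsZeroRegion {q l : ℕ} {lam : YoungDiagram} {μ : RowPartition q}
    (T : SkewCell lam μ.toYD → Fin (l + 1)) (κ : RowPartition (q + 1)) : Prop :=
  Interlaces κ.1 μ.1 ∧ κ.toYD ≤ lam ∧ ∀ c, c.1 ∈ κ.toYD ↔ T c = 0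

theorem IsZeroRegion.unique {q l : ℕ} {lam : YoungDiagram} {μ : RowPartition q}
    {T : SkewCell lam μ.toYD → Fin (l + 1)} {κ κ' : RowPartition (q + 1)}
    (h : IsZeroRegion T κ) (h' : IsZeroRegion T κ') : κ = κ' := by
  have key : ∀ {κ κ' : RowPartition (q + 1)}, IsZeroRegion T κ → IsZeroRegion T κ' →
      κ.toYD ≤ κ'.toYD := by
    intro κ κ' h h' c hc
    by_cases hm : c ∈ μ.toYD
    · exact h'.1.toYD_le hm
    · have hcs : c ∈ lam.cells \ μ.toYD.cells := by simp [h.2.1 hc, hm]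
      exact (h'.2.2 ⟨c, hcs⟩).2 ((h.2.2 ⟨c, hcs⟩).1 hc)
  exact RowPartition.toYD_injective (le_antisymm (key h h') (key h' h))

/-- Monotonicity of `T` makes `μ` together with the zero entries a Young diagram. Column strictness
forces the cell above any of its cells into `μ`, which gives both the interlacing and the bound of
one additional row. -/
theorem IsSkewSSYT.exists_isZeroRegion {q l : ℕ} {lam : YoungDiagram} {μ : RowPartition q}
    {T : SkewCell lam μ.toYD → Fin (l + 1)} (hT : IsSkewSSYT T) :
    ∃ κ : RowPartition (q + 1), IsZeroRegion T κ := by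
  classical
  let Y : YoungDiagram :=
    { cells := lam.cells.filter fun c => c ∈ μ.toYD ∨
        ∃ h : c ∈ lam.cells \ μ.toYD.cells, T ⟨c, h⟩ = 0
      isLowerSet := by
        rintro c d hdc hc
        simp only [Finset.coe_filter, Set.mem_ofPred_eq, YoungDiagram.mem_cells] at hc ⊢
        obtain ⟨h1, h2⟩ := hdc
        refine ⟨lam.up_left_mem h1 h2 hc.1, ?_⟩
        by_cases hd : d ∈ μ.toYD
        · exact Or.inl hd
        · have hcm : c ∉ μ.toYD := fun h => hd (μ.toYD.up_left_mem h1 h2 h)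
          obtain ⟨hc', h0⟩ := hc.2.resolve_left hcm
          refine Or.inr ⟨by simp [hd]; exact lam.up_left_mem h1 h2 hc.1, ?_⟩
          exact le_antisymm ((hT.mono _ ⟨c, hc'⟩ h1 h2).trans_eq h0) (Fin.zero_le _) }
  have hY : ∀ c, c ∈ Y ↔ c ∈ lam ∧ (c ∈ μ.toYD ∨
      ∃ h : c ∈ lam.cells \ μ.toYD.cells, T ⟨c, h⟩ = 0) := by
    intro c
    rw [← YoungDiagram.mem_cells]
    simp [Y]
  have hstrip : ∀ i j, (i + 1, j) ∈ Y → (i, j) ∈ μ.toYD := by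
    intro i j h
    by_contra hm
    have hm' : (i + 1, j) ∉ μ.toYD := fun h => hm (μ.toYD.up_left_mem (Nat.le_succ i) le_rfl h)
    obtain ⟨hl, h⟩ := (hY _).1 h
    obtain ⟨hc, h0⟩ := h.resolve_left hm'
    have hl' : (i, j) ∈ lam := lam.up_left_mem (Nat.le_succ i) le_rfl hl
    have := hT.2.2 ⟨(i, j), by simp [hl', hm]⟩ ⟨(i + 1, j), hc⟩ rfl (Nat.lt_succ_self i)
    rw [h0] at this
    exact absurd this (Fin.not_lt_zero _)
  have hlen : partLength Y ≤ q + 1 := by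
    by_contra h
    have h1 := hstrip q 0 (YoungDiagram.mem_iff_lt_colLen.2 (not_le.1 h))
    exact lt_irrefl _ ((μ.mem_toYD _).1 h1).1
  refine ⟨RowPartition.ofYD (q + 1) Y, ?_, ?_, ?_⟩
  · intro i
    constructor
    · by_contra h
      have h1 := hstrip i (μ.1 i) (YoungDiagram.mem_iff_lt_rowLen.2 (not_le.1 h))
      exact lt_irrefl _ ((μ.mk_mem_toYD _ _).1 h1)
    · by_contra h
      have h1 := (μ.mk_mem_toYD i _).2 (not_le.1 h)
      have h2 : ((i : ℕ), Y.rowLen i) ∈ Y := (hY _).2 ⟨hT.1 h1, Or.inl h1⟩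
      exact lt_irrefl _ (YoungDiagram.mem_iff_lt_rowLen.1 h2)
  · rw [RowPartition.toYD_ofYD hlen]
    exact fun c hc => ((hY c).1 hc).1
  · intro c
    have hc := c.2
    simp only [Finset.mem_sdiff, YoungDiagram.mem_cells] at hc
    rw [RowPartition.toYD_ofYD hlen, hY]
    constructor
    · rintro ⟨_, h⟩
      exact (h.resolve_left hc.2).2
    · exact fun h => ⟨hc.1, Or.inr ⟨c.2, h⟩⟩

/-- Extends a tableau of shape `lam / κ` by zeros. -/
noncomputable def extendByZero {l : ℕ} {lam κ μ : YoungDiagram} (T : SkewCell lam κ → Fin l) :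
    SkewCell lam μ → Fin (l + 1) := fun c =>
  open Classical in
  if h : c.1 ∈ κ then 0 else (T ⟨c.1, by
    have := c.2
    simp only [Finset.mem_sdiff, YoungDiagram.mem_cells] at this ⊢
    exact ⟨this.1, h⟩⟩).succ

theorem extendByZero_of_mem {l : ℕ} {lam κ μ : YoungDiagram} (T : SkewCell lam κ → Fin l)
    {c : SkewCell lam μ} (h : c.1 ∈ κ) : extendByZero T c = 0 := dif_pos h

theorem extendByZero_of_notMem {l : ℕ} {lam κ μ : YoungDiagram} (T : SkewCell lam κ → Fin l)
    {c : SkewCell lam μ} (h : c.1 ∈ lam.cells \ κ.cells) :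
    extendByZero T c = (T ⟨c.1, h⟩).succ :=
  dif_neg (by simp only [Finset.mem_sdiff, YoungDiagram.mem_cells] at h; exact h.2)

theorem mem_sdiff_of_notMem {lam κ μ : YoungDiagram} (c : SkewCell lam μ) (h : c.1 ∉ κ) :
    c.1 ∈ lam.cells \ κ.cells := by
  have := c.2
  simp only [Finset.mem_sdiff, YoungDiagram.mem_cells] at this ⊢
  exact ⟨this.1, h⟩

theorem mem_sdiff_of_le {lam κ μ : YoungDiagram} (hμ : μ ≤ κ) (c : SkewCell lam κ) :
    c.1 ∈ lam.cells \ μ.cells := by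
  have := c.2
  simp only [Finset.mem_sdiff, YoungDiagram.mem_cells] at this ⊢
  exact ⟨this.1, fun h => this.2 (hμ h)⟩

theorem prod_extendByZero {R : Type*} [CommSemiring R] {l : ℕ} {lam κ μ : YoungDiagram}
    (hμ : μ ≤ κ) (hκ : κ ≤ lam) (x : Fin (l + 1) → R) (T : SkewCell lam κ → Fin l) :
    ∏ c : SkewCell lam μ, x (extendByZero T c) =
      x 0 ^ (κ.card - μ.card) * ∏ c, Fin.tail x (T c) := by
  classical
  rw [← Finset.prod_filter_mul_prod_filter_not Finset.univ (fun c : SkewCell lam μ => c.1 ∈ κ)]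
  congr 1
  · rw [Finset.prod_congr rfl (g := fun _ => x 0), Finset.prod_const]
    · congr 1
      rw [YoungDiagram.card, YoungDiagram.card,
        ← Finset.card_sdiff_of_subset (YoungDiagram.cells_subset_iff.2 hμ)]
      refine Finset.card_bij (fun c _ => c.1) ?_ ?_ ?_
      · intro c hc
        have := c.2
        simp only [Finset.mem_filter, Finset.mem_univ, true_and, Finset.mem_sdiff,
          YoungDiagram.mem_cells] at hc this ⊢
        exact ⟨hc, this.2⟩
      · exact fun c _ d _ h => Subtype.ext h
      · intro c hc
        simp only [Finset.mem_sdiff, YoungDiagram.mem_cells] at hc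
        refine ⟨⟨c, ?_⟩, ?_, rfl⟩
        · simp only [Finset.mem_sdiff, YoungDiagram.mem_cells]
          exact ⟨hκ hc.1, hc.2⟩
        · simpa using hc.1
    · intro c hc
      rw [extendByZero_of_mem T (by simpa using hc)]
  · symm
    refine Finset.prod_bij (fun c _ => ⟨c.1, mem_sdiff_of_le hμ c⟩) ?_ ?_ ?_ ?_
    · intro c _
      have := c.2
      simp only [Finset.mem_sdiff, YoungDiagram.mem_cells] at this
      simpa using this.2
    · intro c _ d _ h
      exact Subtype.ext (congrArg (fun e => e.1) h)
    · intro c hc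
      exact ⟨⟨c.1, mem_sdiff_of_notMem c (by simpa using hc)⟩, Finset.mem_univ _, rfl⟩
    · intro c _
      rw [extendByZero_of_notMem T (c := ⟨c.1, mem_sdiff_of_le hμ c⟩) c.2]
      rfl

-- The tableaux with zero region `κ` correspond to tableaux of shape `lam / κ` in the remaining
-- letters, by extending by zero and lowering each letter by one; the zeros contribute `x_0^(|κ| -
-- |μ|)`.
open Classical in
theorem sum_isZeroRegion {R : Type*} [CommSemiring R] {q l : ℕ} {lam : YoungDiagram}
    {μ : RowPartition q} {κ : RowPartition (q + 1)} (hκ : Interlaces κ.1 μ.1)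
    (hlam : κ.toYD ≤ lam) (x : Fin (l + 1) → R) :
    ∑ T : SkewCell lam μ.toYD → Fin (l + 1) with IsSkewSSYT T ∧ IsZeroRegion T κ, ∏ c, x (T c) =
      x 0 ^ (κ.size - μ.size) * skewSchurOver lam κ.toYD (Fin.tail x) := by
  have hμ := hκ.toYD_le
  rw [skewSchurOver, Finset.mul_sum, ← κ.card_toYD, ← μ.card_toYD]
  symm
  refine Finset.sum_bij (fun T _ => extendByZero T) ?_ ?_ ?_ ?_
  · intro T hT
    simp only [Finset.mem_filter, Finset.mem_univ, true_and] at hT ⊢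
    refine ⟨⟨hμ.trans hlam, fun c d h1 h2 => ?_, fun c d h1 h2 => ?_⟩, hκ, hlam, fun c => ?_⟩
    · by_cases hc : c.1 ∈ κ.toYD
      · rw [extendByZero_of_mem T hc]; exact Fin.zero_le _
      · have hd : d.1 ∉ κ.toYD := fun h => hc (κ.toYD.up_left_mem h1.le h2.le h)
        rw [extendByZero_of_notMem T (mem_sdiff_of_notMem c hc),
          extendByZero_of_notMem T (mem_sdiff_of_notMem d hd), Fin.succ_le_succ_iff]
        exact hT.2.1 _ _ h1 h2
    · have hcμ := c.2
      simp only [Finset.mem_sdiff, YoungDiagram.mem_cells] at hcμ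
      have hd : d.1 ∉ κ.toYD := by
        intro h
        refine hcμ.2 (hκ.mem_of_lt h2 (j := c.1.2) ?_)
        rw [h1]; exact h
      rw [extendByZero_of_notMem T (mem_sdiff_of_notMem d hd)]
      by_cases hc : c.1 ∈ κ.toYD
      · rw [extendByZero_of_mem T hc]; exact Fin.succ_pos _
      · rw [extendByZero_of_notMem T (mem_sdiff_of_notMem c hc), Fin.succ_lt_succ_iff]
        exact hT.2.2 _ _ h1 h2
    · constructor
      · exact extendByZero_of_mem T
      · intro h
        by_contra hc
        rw [extendByZero_of_notMem T (mem_sdiff_of_notMem c hc)] at h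
        exact Fin.succ_ne_zero _ h
  · intro T _ T' _ h
    funext c
    have := congrFun h ⟨c.1, mem_sdiff_of_le hμ c⟩
    rw [extendByZero_of_notMem T (c := ⟨c.1, mem_sdiff_of_le hμ c⟩) c.2,
      extendByZero_of_notMem T' (c := ⟨c.1, mem_sdiff_of_le hμ c⟩) c.2] at this
    exact Fin.succ_injective _ this
  · intro T hT
    simp only [Finset.mem_filter, Finset.mem_univ, true_and] at hT
    obtain ⟨hT, hZ⟩ := hT
    have hne : ∀ c : SkewCell lam κ.toYD, T ⟨c.1, mem_sdiff_of_le hμ c⟩ ≠ 0 := by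
      intro c h
      have := c.2
      simp only [Finset.mem_sdiff, YoungDiagram.mem_cells] at this
      exact this.2 ((hZ.2.2 _).2 h)
    refine ⟨fun c => (T ⟨c.1, mem_sdiff_of_le hμ c⟩).pred (hne c), ?_, ?_⟩
    · simp only [Finset.mem_filter, Finset.mem_univ, true_and]
      refine ⟨hlam, fun c d h1 h2 => ?_, fun c d h1 h2 => ?_⟩
      · exact Fin.pred_le_pred_iff.2 (hT.2.1 _ _ h1 h2)
      · exact Fin.pred_lt_pred_iff.2 (hT.2.2 _ _ h1 h2)
    · funext c
      by_cases hc : c.1 ∈ κ.toYD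
      · rw [extendByZero_of_mem _ hc, (hZ.2.2 c).1 hc]
      · rw [extendByZero_of_notMem _ (mem_sdiff_of_notMem c hc), Fin.succ_pred]
  · intro T _
    exact (prod_extendByZero hμ hlam x T).symm

theorem finite_toYD_le (q : ℕ) (lam : YoungDiagram) :
    {κ : RowPartition q | κ.toYD ≤ lam}.Finite := by
  refine Set.Finite.of_finite_image (f := fun κ => κ.toYD.cells) ?_ ?_
  · refine (lam.cells.powerset.finite_toSet).subset ?_
    rintro _ ⟨κ, hκ, rfl⟩
    simpa using YoungDiagram.cells_subset_iff.2 hκ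
  · intro κ _ κ' _ h
    exact RowPartition.toYD_injective (YoungDiagram.ext h)

/-- Branching of skew Schur functions: removing the boxes with the smallest letter. -/
theorem skewSchurOver_succ {R : Type*} [CommSemiring R] [TopologicalSpace R] {q l : ℕ}
    (lam : YoungDiagram) (μ : RowPartition q) (x : Fin (l + 1) → R) :
    HasSum (fun κ : RowPartition (q + 1) => if Interlaces κ.1 μ.1 then
      x 0 ^ (κ.size - μ.size) * skewSchurOver lam κ.toYD (Fin.tail x) else 0)
      (skewSchurOver lam μ.toYD x) := by
  classical
  set S := (finite_toYD_le (q + 1) lam).toFinset with hS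
  have h1 : skewSchurOver lam μ.toYD x = ∑ κ ∈ S, if Interlaces κ.1 μ.1 then
      x 0 ^ (κ.size - μ.size) * skewSchurOver lam κ.toYD (Fin.tail x) else 0 := by
    have h2 : ∀ T : SkewCell lam μ.toYD → Fin (l + 1), IsSkewSSYT T → ∏ c, x (T c) =
        ∑ κ ∈ S, if IsZeroRegion T κ then ∏ c, x (T c) else 0 := by
      intro T hT
      obtain ⟨κ, hκ⟩ := hT.exists_isZeroRegion
      rw [Finset.sum_eq_single κ, if_pos hκ]
      · exact fun κ' _ hne => if_neg fun h => hne (h.unique hκ)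
      · exact fun h => absurd (by simpa [hS] using hκ.2.1) h
    rw [skewSchurOver, Finset.sum_congr rfl fun T hT => h2 T (Finset.mem_filter.1 hT).2,
      Finset.sum_comm]
    refine Finset.sum_congr rfl fun κ hκ => ?_
    rw [← Finset.sum_filter, Finset.filter_filter]
    split_ifs with h
    · exact sum_isZeroRegion h (by simpa [hS] using hκ) x
    · rw [Finset.filter_false_of_mem, Finset.sum_empty]
      exact fun T _ hT => h hT.2.1
  rw [h1]
  refine hasSum_sum_of_ne_finset_zero fun κ hκ => ?_
  rw [skewSchurOver_eq_zero _ (by simpa [hS] using hκ)]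
  simp

/-! ### Vanishing, uniform bounds and summability of skew Schur functions. -/

theorem skewSchur_eq_zero_of_partLength {lam mu : YoungDiagram} {l : ℕ} (x : Fin l → ℂ)
    (h : partLength mu + l < partLength lam) : skewSchur lam mu x = 0 := by
  classical
  rw [skewSchur, Finset.filter_false_of_mem, Finset.sum_empty]
  intro T _ hT
  -- The first column of the skew shape contains at least `l + 1` cells, too many for strictly
  -- increasing entries among `l` letters.
  have hmem : ∀ i : Fin (l + 1), (partLength mu + (i : ℕ), 0) ∈ lam.cells \ mu.cells := by
    intro i
    simp only [Finset.mem_sdiff, YoungDiagram.mem_cells, YoungDiagram.mem_iff_lt_colLen, not_lt]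
    unfold partLength at *
    have := i.2
    constructor <;> omega
  have hmono : StrictMono fun i : Fin (l + 1) => T ⟨_, hmem i⟩ := by
    intro i j hij
    exact hT.2.2 _ _ rfl (Nat.add_lt_add_left hij _)
  have := Fintype.card_le_of_injective _ hmono.injective
  simp at this

theorem skewSchurOver_nonneg (lam mu : YoungDiagram) {l : ℕ} {x : Fin l → ℝ} (hx : ∀ i, 0 ≤ x i) :
    0 ≤ skewSchurOver lam mu x :=
  Finset.sum_nonneg fun _ _ => Finset.prod_nonneg fun _ _ => hx _

theorem norm_skewSchurOver_le (lam mu : YoungDiagram) {l : ℕ} (x : Fin l → ℂ) :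
    ‖skewSchurOver lam mu x‖ ≤ skewSchurOver lam mu fun i => ‖x i‖ := by
  refine (norm_sum_le _ _).trans_eq (Finset.sum_congr rfl fun T _ => ?_)
  rw [norm_prod]

/-- Subtracting `μ`, padded by a zero part, embeds the admissible `κ` into `ℕ^(q+1)`. The resulting
bound does not depend on `μ`. -/
theorem tsum_interlaces_pow_le {q : ℕ} (μ : RowPartition q) {r : ℝ} (h0 : 0 ≤ r) (h1 : r < 1) :
    (Summable fun κ : RowPartition (q + 1) =>
      if Interlaces κ.1 μ.1 then r ^ (κ.size - μ.size) else 0) ∧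
    ∑' κ : RowPartition (q + 1), (if Interlaces κ.1 μ.1 then r ^ (κ.size - μ.size) else 0) ≤
      ∑' s : Fin (q + 1) → ℕ, r ^ ∑ i, s i := by
  let ν : Fin (q + 1) → ℕ := Fin.snoc (α := fun _ => ℕ) μ.1 0
  have hν : ∑ i, ν i = μ.size := by
    rw [Fin.sum_univ_castSucc]; simp [ν, RowPartition.size]
  have hle : ∀ κ : RowPartition (q + 1), Interlaces κ.1 μ.1 → ∀ i, ν i ≤ κ.1 i := by
    intro κ h i
    cases i using Fin.lastCases with
    | last => simp [ν]
    | cast i => simpa [ν] using (h i).2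
  let S : Set (RowPartition (q + 1)) := {κ | Interlaces κ.1 μ.1}
  let e : S → Fin (q + 1) → ℕ := fun κ i => κ.1.1 i - ν i
  have he : Function.Injective e := by
    intro κ κ' h
    refine Subtype.ext (Subtype.ext (funext fun i => ?_))
    have h1 := congrFun h i
    have h2 := hle κ.1 κ.2 i
    have h3 := hle κ'.1 κ'.2 i
    simp only [e] at h1
    omega
  have hval : ∀ κ : S, r ^ (∑ i, e κ i) = r ^ (κ.1.size - μ.size) := by
    intro κ
    simp only [e]
    rw [Finset.sum_tsub_distrib _ fun i _ => hle κ.1 κ.2 i, hν]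
    rfl
  have hind : (fun κ : RowPartition (q + 1) =>
      if Interlaces κ.1 μ.1 then r ^ (κ.size - μ.size) else 0) =
      S.indicator fun κ => r ^ (κ.size - μ.size) := by
    funext κ
    by_cases h : Interlaces κ.1 μ.1
    · rw [if_pos h, Set.indicator_of_mem (show κ ∈ S from h)]
    · rw [if_neg h, Set.indicator_of_notMem (show κ ∉ S from h)]
  have hs := summable_pow_sum (q + 1) h0 h1
  have hs' : Summable fun κ : S => r ^ (κ.1.size - μ.size) :=
    (hs.comp_injective he).congr fun κ => hval κ
  rw [hind, ← tsum_subtype S fun κ => r ^ (κ.size - μ.size)]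
  refine ⟨summable_subtype_iff_indicator.1 hs', ?_⟩
  exact Summable.tsum_le_tsum_of_inj e he (fun _ _ => pow_nonneg h0 _)
    (fun κ => (hval κ).ge) hs' hs

theorem summable_branching {α : Type*} {q : ℕ} (μ : RowPartition q) {r : ℝ} (h0 : 0 ≤ r)
    (h1 : r < 1) (g : RowPartition (q + 1) → α → ℝ) (hg : ∀ κ a, 0 ≤ g κ a) (B : ℝ)
    (hs : ∀ κ, Summable (g κ)) (hB : ∀ κ, ∑' a, g κ a ≤ B) :
    (Summable fun p : RowPartition (q + 1) × α =>
      if Interlaces p.1.1 μ.1 then r ^ (p.1.size - μ.size) * g p.1 p.2 else 0) ∧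
    ∑' κ : RowPartition (q + 1), ∑' a,
      (if Interlaces κ.1 μ.1 then r ^ (κ.size - μ.size) * g κ a else 0) ≤
      (∑' s : Fin (q + 1) → ℕ, r ^ ∑ i, s i) * B := by
  obtain ⟨hi, hle⟩ := tsum_interlaces_pow_le μ h0 h1
  have hB0 : 0 ≤ B := (tsum_nonneg (hg ⟨0, fun _ _ _ => le_rfl⟩)).trans (hB _)
  have hin : ∀ κ : RowPartition (q + 1), ∑' a,
      (if Interlaces κ.1 μ.1 then r ^ (κ.size - μ.size) * g κ a else 0) ≤
      (if Interlaces κ.1 μ.1 then r ^ (κ.size - μ.size) else 0) * B := by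
    intro κ
    split_ifs with h
    · rw [tsum_mul_left]
      exact mul_le_mul_of_nonneg_left (hB κ) (pow_nonneg h0 _)
    · simp
  have hnn : ∀ (κ : RowPartition (q + 1)) (a : α),
      0 ≤ if Interlaces κ.1 μ.1 then r ^ (κ.size - μ.size) * g κ a else 0 := by
    intro κ a
    split_ifs
    · exact mul_nonneg (pow_nonneg h0 _) (hg κ a)
    · exact le_rfl
  have hsum : Summable fun κ : RowPartition (q + 1) => ∑' a,
      (if Interlaces κ.1 μ.1 then r ^ (κ.size - μ.size) * g κ a else 0) :=
    Summable.of_nonneg_of_le (fun κ => tsum_nonneg (hnn κ)) hin (hi.mul_right B)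
  constructor
  · refine (summable_prod_of_nonneg fun p => hnn p.1 p.2).2 ⟨fun κ => ?_, hsum⟩
    dsimp only
    split_ifs
    · exact (hs κ).mul_left _
    · exact summable_zero
  · refine (hsum.tsum_le_tsum hin (hi.mul_right B)).trans ?_
    rw [tsum_mul_right]
    exact mul_le_mul_of_nonneg_right hle hB0

/-- The uniformity in `μ` is essential: it makes the outer sums bounded coefficients of the
alternant series, and it carries the induction on the number of letters, where the bound must serve
all `κ` at once. -/
theorem exists_tsum_skewSchurOver_le {l : ℕ} (x : Fin l → ℝ) (h0 : ∀ i, 0 ≤ x i)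
    (h1 : ∀ i, x i < 1) (q : ℕ) : ∃ B : ℝ, ∀ μ : RowPartition q,
      (Summable fun lam => skewSchurOver lam μ.toYD x) ∧
      ∑' lam, skewSchurOver lam μ.toYD x ≤ B := by
  induction l generalizing q with
  | zero =>
    classical
    refine ⟨1, fun μ => ?_⟩
    simp only [skewSchurOver_fin_zero]
    have := hasSum_ite_eq μ.toYD (1 : ℝ)
    exact ⟨this.summable, this.tsum_eq.le⟩
  | succ l ih =>
    obtain ⟨B, hB⟩ := ih (Fin.tail x) (fun i => h0 _) (fun i => h1 _) (q + 1)
    refine ⟨(∑' s : Fin (q + 1) → ℕ, x 0 ^ ∑ i, s i) * B, fun μ => ?_⟩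
    obtain ⟨hs, hle⟩ := summable_branching μ (h0 0) (h1 0)
      (fun κ lam => skewSchurOver lam κ.toYD (Fin.tail x))
      (fun κ lam => skewSchurOver_nonneg _ _ fun i => h0 _) B (fun κ => (hB κ).1)
      (fun κ => (hB κ).2)
    have h2 : ∀ lam, skewSchurOver lam μ.toYD x = ∑' κ : RowPartition (q + 1),
        if Interlaces κ.1 μ.1 then
          x 0 ^ (κ.size - μ.size) * skewSchurOver lam κ.toYD (Fin.tail x) else 0 :=
      fun lam => (skewSchurOver_succ lam μ x).tsum_eq.symm
    simp only [h2]
    refine ⟨hs.prod_symm.prod, ?_⟩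
    refine le_trans (le_of_eq ?_) hle
    exact Summable.tsum_comm (f := fun (κ : RowPartition (q + 1)) lam =>
      if Interlaces κ.1 μ.1 then
          x 0 ^ (κ.size - μ.size) * skewSchurOver lam κ.toYD (Fin.tail x) else 0) hs

/-- The sum over all `lam` of the skew Schur functions `s_{lam/μ}(x)`. -/
noncomputable def outerSkewSum {l q : ℕ} (x : Fin l → ℂ) (μ : RowPartition q) : ℂ :=
  ∑' lam, skewSchurOver lam μ.toYD x

theorem exists_norm_outerSkewSum_le {l : ℕ} (x : Fin l → ℂ) (hx : ∀ i, ‖x i‖ < 1) (q : ℕ) :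
    ∃ B : ℝ, ∀ μ : RowPartition q, ‖outerSkewSum x μ‖ ≤ B := by
  obtain ⟨B, hB⟩ := exists_tsum_skewSchurOver_le (fun i => ‖x i‖) (fun i => norm_nonneg _) hx q
  exact ⟨B, fun μ => (tsum_of_norm_bounded (hB μ).1.hasSum
    fun lam => norm_skewSchurOver_le lam μ.toYD x).trans (hB μ).2⟩

theorem outerSkewSum_zero {q : ℕ} (x : Fin 0 → ℂ) (μ : RowPartition q) : outerSkewSum x μ = 1 := by
  classical
  simp only [outerSkewSum, skewSchurOver_fin_zero]
  exact tsum_ite_eq _ _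

theorem outerSkewSum_succ {l q : ℕ} (x : Fin (l + 1) → ℂ) (hx : ∀ i, ‖x i‖ < 1)
    (μ : RowPartition q) : outerSkewSum x μ = ∑' κ : RowPartition (q + 1),
      if Interlaces κ.1 μ.1 then
        x 0 ^ (κ.size - μ.size) * outerSkewSum (Fin.tail x) κ else 0 := by
  obtain ⟨B, hB⟩ := exists_tsum_skewSchurOver_le (fun i => ‖Fin.tail x i‖)
    (fun i => norm_nonneg _) (fun i => hx _) (q + 1)
  have hs := (summable_branching μ (norm_nonneg (x 0)) (hx 0)
      (fun κ lam => skewSchurOver lam κ.toYD fun i => ‖Fin.tail x i‖)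
      (fun κ lam => skewSchurOver_nonneg _ _ fun i => norm_nonneg _) B (fun κ => (hB κ).1)
      (fun κ => (hB κ).2)).1
  have hs' : Summable fun p : RowPartition (q + 1) × YoungDiagram =>
      if Interlaces p.1.1 μ.1 then
        x 0 ^ (p.1.size - μ.size) * skewSchurOver p.2 p.1.toYD (Fin.tail x) else 0 := by
    refine Summable.of_norm_bounded hs fun p => ?_
    split_ifs
    · rw [norm_mul, norm_pow]
      exact mul_le_mul_of_nonneg_left (norm_skewSchurOver_le _ _ _) (by positivity)
    · rw [norm_zero]
  have h2 : ∀ lam, skewSchurOver lam μ.toYD x = ∑' κ : RowPartition (q + 1),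
      if Interlaces κ.1 μ.1 then
        x 0 ^ (κ.size - μ.size) * skewSchurOver lam κ.toYD (Fin.tail x) else 0 :=
    fun lam => (skewSchurOver_succ lam μ x).tsum_eq.symm
  simp only [outerSkewSum, h2]
  refine (Summable.tsum_comm (f := fun (κ : RowPartition (q + 1)) lam =>
      if Interlaces κ.1 μ.1 then
          x 0 ^ (κ.size - μ.size) * skewSchurOver lam κ.toYD (Fin.tail x) else 0) hs').trans ?_
  refine tsum_congr fun κ => ?_
  split_ifs
  · rw [tsum_mul_left]
  · exact tsum_zero

/-! ### The generating series of the outer sums against alternants. -/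

theorem continuous_alternant {q : ℕ} (μ : Fin q → ℕ) : Continuous (alternant μ) := by
  have : alternant μ = fun z => ∑ σ : Equiv.Perm (Fin q), ((Equiv.Perm.sign σ : ℤ) : ℂ) *
      ∏ i, z i ^ (μ (σ i) + (Fin.rev (σ i) : ℕ)) := funext fun z => alternant_eq_sum μ z
  rw [this]
  fun_prop

/-- Dominated convergence with a geometric majorant. Both `t` and `y` may move: moving `y` avoids
zeros of `∏ (x_0 - z_i)`, and moving `t` reaches `t = 0`. -/
theorem continuousAt_tsum_alternant {q : ℕ} (g : RowPartition q → ℂ) (C : ℝ) (hg : ∀ μ, ‖g μ‖ ≤ C)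
    (t : ℂ → ℂ) (y : ℂ → Fin q → ℂ) (ht : Continuous t) (hy : Continuous y)
    (h : ‖t 0‖ * ‖y 0‖ < 1) :
    ContinuousAt (fun s => ∑' μ : RowPartition q, g μ * (t s ^ μ.size * alternant μ.1 (y s))) 0 := by
  obtain ⟨r, hr, hr1⟩ := exists_between h
  have hr0 : 0 ≤ r := (by positivity : 0 ≤ ‖t 0‖ * ‖y 0‖).trans hr.le
  set Y := ‖y 0‖ + 1
  have h1 : ∀ᶠ s in nhds (0 : ℂ), ‖t s‖ * ‖y s‖ < r :=
    (ht.norm.mul hy.norm).continuousAt.eventually (gt_mem_nhds hr)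
  have h2 : ∀ᶠ s in nhds (0 : ℂ), ‖y s‖ < Y :=
    hy.norm.continuousAt.eventually (gt_mem_nhds (lt_add_one _))
  refine tendsto_tsum_of_dominated_convergence
    (bound := fun μ => C * (q.factorial * Y ^ ∑ i : Fin q, (Fin.rev i : ℕ)) * r ^ μ.size)
    ((summable_pow_size q hr0 hr1).mul_left _) (fun μ => ?_) ?_
  · exact (continuous_const.mul ((ht.pow _).mul ((continuous_alternant μ.1).comp hy))).continuousAt
  · filter_upwards [h1, h2] with s hs1 hs2 μ
    have hC : 0 ≤ C := (norm_nonneg _).trans (hg μ)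
    rw [norm_mul, norm_mul, norm_pow, mul_assoc]
    refine mul_le_mul (hg μ) ?_ (by positivity) hC
    calc ‖t s‖ ^ μ.size * ‖alternant μ.1 (y s)‖
        ≤ ‖t s‖ ^ μ.size * ((q.factorial * ‖y s‖ ^ ∑ i : Fin q, (Fin.rev i : ℕ)) *
            ‖y s‖ ^ μ.size) :=
          mul_le_mul_of_nonneg_left (norm_alternant_le μ.1 _ fun i => norm_le_pi_norm _ i)
            (by positivity)
      _ = (q.factorial * ‖y s‖ ^ ∑ i : Fin q, (Fin.rev i : ℕ)) * (‖t s‖ * ‖y s‖) ^ μ.size := by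
          rw [mul_pow]; ring
      _ ≤ _ := by
          have := hs2.le
          have := hs1.le
          gcongr

theorem eq_of_continuousAt_of_eventually_ne {f g : ℂ → ℂ} (hf : ContinuousAt f 0)
    (hg : ContinuousAt g 0) (h : ∀ᶠ s in nhdsWithin (0 : ℂ) {0}ᶜ, f s = g s) : f 0 = g 0 :=
  tendsto_nhds_unique_of_eventuallyEq (hf.tendsto.mono_left nhdsWithin_le_nhds)
    (hg.tendsto.mono_left nhdsWithin_le_nhds) h

/-- The prefactor of the product formula. -/
noncomputable def schurProd {m : ℕ} (x : Fin m → ℂ) : ℂ :=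
  (∏ i, 1 / (1 - x i)) * ∏ i, ∏ j ∈ Finset.Ioi i, 1 / (1 - x i * x j)

theorem schurProd_succ {m : ℕ} (x : Fin (m + 1) → ℂ) :
    schurProd x = 1 / (1 - x 0) * (∏ j, 1 / (1 - Fin.tail x j * x 0)) * schurProd (Fin.tail x) := by
  simp only [schurProd, Fin.prod_univ_succ, Fin.prod_Ioi_zero, Fin.prod_Ioi_succ, Fin.tail,
    mul_comm (x 0)]
  ring

/-- Induction on the number of letters: up to `∏ (x_0 - z_i)`, the series in `x` and `z` equals the
series for the remaining letters in the variables `(x_0, z)`. -/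
theorem tsum_outerSkewSum_alternant {m : ℕ} (x : Fin m → ℂ) (hx : ∀ i, ‖x i‖ < 1) (q : ℕ)
    (z : Fin (q + 1) → ℂ) (hz : ∀ i, ‖z i‖ < 1) :
    ∑' μ : RowPartition (q + 1), outerSkewSum x μ * alternant μ.1 z =
      schurProd x * (∏ i, ∏ j, 1 / (1 - x i * z j)) * littlewoodProd z := by
  induction m generalizing q with
  | zero =>
    simp only [outerSkewSum_zero, one_mul, tsum_alternant q z hz]
    simp [schurProd]
  | succ m ih =>
    set x' := Fin.tail x
    have hx' : ∀ i, ‖x' i‖ < 1 := fun i => hx _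
    have key : ∀ z : Fin (q + 1) → ℂ, (∀ i, ‖z i‖ < 1) → (∏ i, (x 0 - z i)) *
        ∑' μ : RowPartition (q + 1), outerSkewSum x μ * alternant μ.1 z = (∏ i, (x 0 - z i)) *
          (schurProd x * (∏ i, ∏ j, 1 / (1 - x i * z j)) * littlewoodProd z) := by
      intro z hz
      obtain ⟨C, hC⟩ := exists_norm_outerSkewSum_le x' hx' (q + 2)
      have h1 := tsum_alternant_cons (fun κ => outerSkewSum x' κ) C hC (x 0) (hx 0) z hz
      have h2 := ih x' hx' (q + 1) (Fin.cons (x 0) z)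
        (fun i => by cases i using Fin.cases <;> simp [hx, hz])
      rw [h2] at h1
      simp only [outerSkewSum_succ x hx]
      rw [← h1, schurProd_succ, littlewoodProd_cons]
      simp only [Fin.prod_univ_succ, Fin.cons_zero, Fin.cons_succ, Finset.prod_mul_distrib]
      simp only [x', Fin.tail]
      ring
    obtain ⟨C, hC⟩ := exists_norm_outerSkewSum_le x hx (q + 1)
    have hz1 : ‖z‖ < 1 := (pi_norm_lt_iff one_pos).2 hz
    -- All variables are shifted by a common `s`. For small nonzero `s` no `z_i + s` equals `x_0`,
    -- so the factor can be cancelled; then `s` tends to zero.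
    have hzs : Continuous fun (s : ℂ) (i : Fin (q + 1)) => z i + s := by fun_prop
    have hL := continuousAt_tsum_alternant (fun μ => outerSkewSum x μ) C hC (fun _ => 1)
      (fun s i => z i + s) continuous_const hzs (by simpa using hz1)
    -- The Littlewood product is handled through its series, whose continuity is already available.
    have hW := continuousAt_tsum_alternant (fun μ : RowPartition (q + 1) => 1) 1 (by simp)
      (fun _ => 1) (fun s i => z i + s) continuous_const hzs (by simpa using hz1)
    have hP : ContinuousAt (fun s : ℂ => ∏ i, ∏ j, 1 / (1 - x i * (z j + s))) 0 := by
      refine tendsto_finsetProd _ fun i _ => tendsto_finsetProd _ fun j _ => ?_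
      refine ContinuousAt.div continuousAt_const (by fun_prop) ?_
      simpa using one_sub_mul_ne_zero (hx i) (hz j)
    have hev : ∀ᶠ s in nhds (0 : ℂ), ∀ i, ‖z i + s‖ < 1 := by
      refine Filter.eventually_all.2 fun i => ?_
      have : Continuous fun s : ℂ => ‖z i + s‖ := by fun_prop
      exact this.continuousAt.eventually (gt_mem_nhds (by simpa using hz i))
    have hne : ∀ᶠ s in nhdsWithin (0 : ℂ) {0}ᶜ, ∀ i, x 0 - (z i + s) ≠ 0 := by
      refine Filter.eventually_all.2 fun i => ?_
      by_cases h : x 0 = z i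
      · filter_upwards [self_mem_nhdsWithin] with s hs
        rw [h]
        simpa using hs
      · refine eventually_nhdsWithin_of_eventually_nhds ?_
        have : Continuous fun s : ℂ => x 0 - (z i + s) := by fun_prop
        exact this.continuousAt.eventually_ne (by simpa [sub_eq_zero] using h)
    have := eq_of_continuousAt_of_eventually_ne hL ((continuousAt_const (y := schurProd x)).mul hP
      |>.mul hW) (by
      filter_upwards [hne, eventually_nhdsWithin_of_eventually_nhds hev] with s hs1 hs2
      simp only [one_pow, one_mul, Pi.mul_apply]
      rw [tsum_alternant q _ hs2]
      exact mul_left_cancel₀ (Finset.prod_ne_zero_iff.2 fun i _ => hs1 i) (key _ hs2))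
    simpa [tsum_alternant q z hz] using this

theorem prod_prod_Ioi_const {q : ℕ} (t : ℂ) :
    ∏ i : Fin q, ∏ _j ∈ Finset.Ioi i, t = t ^ ∑ i : Fin q, (Fin.rev i : ℕ) := by
  rw [← Finset.prod_pow_eq_pow_sum]
  refine Finset.prod_congr rfl fun i _ => ?_
  rw [Finset.prod_const, Fin.card_Ioi, Fin.val_rev]
  congr 1
  omega

/-- Substituting `z = t y` produces on both sides the power of `t` coming from the Vandermonde
degree. It cancels for `t ≠ 0`, and `t = 0` follows by continuity. -/
theorem tsum_outerSkewSum_pow_alternant {m : ℕ} (x : Fin m → ℂ) (hx : ∀ i, ‖x i‖ < 1) (q : ℕ)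
    (t : ℂ) (y : Fin (q + 1) → ℂ) (hty : ∀ i, ‖t * y i‖ < 1) :
    ∑' μ : RowPartition (q + 1), outerSkewSum x μ * (t ^ μ.size * alternant μ.1 y) =
      schurProd x * (∏ i, ∏ j, 1 / (1 - x i * t * y j)) * ((∏ i, 1 / (1 - t * y i)) *
        ∏ i, ∏ j ∈ Finset.Ioi i, (y i - y j) / (1 - t ^ 2 * y i * y j)) := by
  have key : ∀ t : ℂ, t ≠ 0 → (∀ i, ‖t * y i‖ < 1) →
      ∑' μ : RowPartition (q + 1), outerSkewSum x μ * (t ^ μ.size * alternant μ.1 y) =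
      schurProd x * (∏ i, ∏ j, 1 / (1 - x i * t * y j)) * ((∏ i, 1 / (1 - t * y i)) *
        ∏ i, ∏ j ∈ Finset.Ioi i, (y i - y j) / (1 - t ^ 2 * y i * y j)) := by
    intro t ht hty
    have h := tsum_outerSkewSum_alternant x hx q (fun i => t * y i) hty
    have h1 : ∀ μ : RowPartition (q + 1), outerSkewSum x μ * alternant μ.1 (fun i => t * y i) =
        t ^ (∑ i : Fin (q + 1), (Fin.rev i : ℕ)) *
          (outerSkewSum x μ * (t ^ μ.size * alternant μ.1 y)) := by
      intro μ
      rw [alternant_smul, RowPartition.size]; ring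
    have h2 : ∏ i, ∏ j ∈ Finset.Ioi i, (t * y i - t * y j) / (1 - t * y i * (t * y j)) =
        t ^ (∑ i : Fin (q + 1), (Fin.rev i : ℕ)) *
          ∏ i, ∏ j ∈ Finset.Ioi i, (y i - y j) / (1 - t ^ 2 * y i * y j) := by
      rw [← prod_prod_Ioi_const, ← Finset.prod_mul_distrib]
      refine Finset.prod_congr rfl fun i _ => ?_
      rw [← Finset.prod_mul_distrib]
      refine Finset.prod_congr rfl fun j _ => ?_
      rw [← mul_div_assoc]
      congr 1 <;> ring
    simp only [h1] at h
    rw [tsum_mul_left, littlewoodProd, h2] at h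
    refine mul_left_cancel₀ (pow_ne_zero (∑ i : Fin (q + 1), (Fin.rev i : ℕ)) ht) (h.trans ?_)
    simp only [← mul_assoc]
    ring
  by_cases ht : t = 0
  swap
  · exact key t ht hty
  subst ht
  obtain ⟨C, hC⟩ := exists_norm_outerSkewSum_le x hx (q + 1)
  have hL := continuousAt_tsum_alternant (fun μ => outerSkewSum x μ) C hC (fun s => s)
    (fun s => y) continuous_id continuous_const (by simp)
  have hR : ContinuousAt (fun t => schurProd x * (∏ i, ∏ j, 1 / (1 - x i * t * y j)) *
      ((∏ i, 1 / (1 - t * y i)) *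
        ∏ i, ∏ j ∈ Finset.Ioi i, (y i - y j) / (1 - t ^ 2 * y i * y j))) 0 := by
    refine (continuousAt_const.mul ?_).mul (ContinuousAt.mul ?_ ?_)
    · refine tendsto_finsetProd _ fun i _ => tendsto_finsetProd _ fun j _ => ?_
      exact ContinuousAt.div continuousAt_const (by fun_prop) (by simp)
    · refine tendsto_finsetProd _ fun i _ => ?_
      exact ContinuousAt.div continuousAt_const (by fun_prop) (by simp)
    · refine tendsto_finsetProd _ fun i _ => tendsto_finsetProd _ fun j _ => ?_
      exact ContinuousAt.div continuousAt_const (by fun_prop) (by simp)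
  refine eq_of_continuousAt_of_eventually_ne hL hR ?_
  have hev : ∀ᶠ s in nhds (0 : ℂ), ∀ i, ‖s * y i‖ < 1 := by
    refine Filter.eventually_all.2 fun i => ?_
    have : Continuous fun s : ℂ => ‖s * y i‖ := by fun_prop
    exact this.continuousAt.eventually (gt_mem_nhds (by simp))
  filter_upwards [self_mem_nhdsWithin, eventually_nhdsWithin_of_eventually_nhds hev] with s h1 h2
  exact key s h1 h2

/-! ### Integration over tori and orthogonality of alternants. -/

open MeasureTheory in
theorem hasSum_torusIntegral {ι : Type*} [Countable ι] {p : ℕ} {f : ι → (Fin p → ℂ) → ℂ}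
    {c : Fin p → ℂ} {R : Fin p → ℝ} {u : ι → ℝ}
    (hf : ∀ i, Continuous fun θ => f i (torusMap c R θ))
    (hu : ∀ i θ, ‖f i (torusMap c R θ)‖ ≤ u i) (hs : Summable u) :
    HasSum (fun i => torusIntegral (f i) c R) (torusIntegral (fun y => ∑' i, f i y) c R) := by
  have hfin : IsFiniteMeasure (volume.restrict (Set.Icc (0 : Fin p → ℝ) fun _ => 2 * Real.pi)) :=
    ⟨by simpa using measure_Icc_lt_top⟩
  refine hasSum_integral_of_dominated_convergence (fun i _ => (∏ j, |R j|) * u i) ?_ ?_ ?_ ?_ ?_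
  · intro i
    have hc : Continuous fun θ : Fin p → ℝ =>
        ∏ i, (R i : ℂ) * Complex.exp (θ i * Complex.I) * Complex.I := by fun_prop
    exact (hc.smul (hf i)).aestronglyMeasurable
  · intro i
    refine Filter.Eventually.of_forall fun θ => ?_
    rw [norm_smul]
    have : ‖∏ i, (R i : ℂ) * Complex.exp (θ i * Complex.I) * Complex.I‖ = ∏ j, |R j| := by
      simp
    rw [this]
    exact mul_le_mul_of_nonneg_left (hu i θ) (Finset.prod_nonneg fun _ _ => abs_nonneg _)
  · exact Filter.Eventually.of_forall fun θ => hs.mul_left _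
  · exact integrable_const _
  · refine Filter.Eventually.of_forall fun θ => ?_
    exact (Summable.of_norm_bounded hs fun i => hu i θ).hasSum.const_smul _

theorem torusIntegral_congr {p : ℕ} {f g : (Fin p → ℂ) → ℂ} {c : Fin p → ℂ} {R : Fin p → ℝ}
    (h : ∀ θ, f (torusMap c R θ) = g (torusMap c R θ)) :
    torusIntegral f c R = torusIntegral g c R := by
  simp only [torusIntegral, h]

open MeasureTheory in
theorem torusIntegrable_of_continuous {p : ℕ} {f : (Fin p → ℂ) → ℂ} {c : Fin p → ℂ}
    {R : Fin p → ℝ} (h : Continuous fun θ => f (torusMap c R θ)) : TorusIntegrable f c R :=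
  h.integrableOn_Icc

theorem torusIntegral_finset_sum {ι : Type*} (s : Finset ι) {p : ℕ} {f : ι → (Fin p → ℂ) → ℂ}
    {c : Fin p → ℂ} {R : Fin p → ℝ} (h : ∀ i ∈ s, TorusIntegrable (f i) c R) :
    torusIntegral (fun y => ∑ i ∈ s, f i y) c R = ∑ i ∈ s, torusIntegral (f i) c R := by
  simp only [torusIntegral, Finset.smul_sum]
  exact MeasureTheory.integral_finsetSum s fun i hi => (h i hi).function_integrable

open MeasureTheory in
theorem torusIntegral_prod {p : ℕ} (f : Fin p → ℂ → ℂ) (R : Fin p → ℝ) :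
    torusIntegral (fun y => ∏ i, f i (y i)) 0 R = ∏ i, circleIntegral (f i) 0 (R i) := by
  have h1 : (Set.Icc (0 : Fin p → ℝ) fun _ => 2 * Real.pi) =
      Set.univ.pi fun _ => Set.Icc 0 (2 * Real.pi) := (Set.pi_univ_Icc _ _).symm
  simp only [torusIntegral, smul_eq_mul, ← Finset.prod_mul_distrib]
  rw [h1, volume_pi, Measure.restrict_pi_pi]
  refine (integral_fintype_prod_eq_prod (E := fun _ : Fin p => ℝ)
    (μ := fun _ => (volume : Measure ℝ).restrict (Set.Icc 0 (2 * Real.pi)))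
    fun i (θ : ℝ) => (R i : ℂ) * Complex.exp (θ * Complex.I) *
    Complex.I * f i (0 + R i * Complex.exp (θ * Complex.I))).trans ?_
  refine Finset.prod_congr rfl fun i _ => ?_
  rw [circleIntegral_def_Icc]
  refine setIntegral_congr_fun measurableSet_Icc fun θ _ => ?_
  simp [deriv_circleMap, circleMap]

theorem torusIntegral_prod_zpow {p : ℕ} (e : Fin p → ℤ) {R : Fin p → ℝ} (hR : ∀ i, 0 < R i) :
    torusIntegral (fun y => ∏ i, y i ^ e i) 0 R =
      if ∀ i, e i = -1 then (2 * (Real.pi : ℂ) * Complex.I) ^ p else 0 := by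
  rw [torusIntegral_prod (fun i z => z ^ e i)]
  split_ifs with h
  · have : ∀ i, circleIntegral (fun z => z ^ e i) 0 (R i) = 2 * (Real.pi : ℂ) * Complex.I := by
      intro i
      have := circleIntegral.integral_sub_inv_of_mem_ball (c := 0) (w := 0) (R := R i)
        (by simpa using hR i)
      simpa [h i] using this
    simp [this]
  · push Not at h
    obtain ⟨i, hi⟩ := h
    refine Finset.prod_eq_zero (Finset.mem_univ i) ?_
    simpa using circleIntegral.integral_sub_zpow_of_ne hi 0 0 (R i)

theorem RowPartition.strictAnti_add_rev {q : ℕ} (μ : RowPartition q) :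
    StrictAnti fun i => μ.1 i + (Fin.rev i : ℕ) := by
  intro i j h
  have h1 := μ.2 h.le
  have h2 : (Fin.rev j : ℕ) < Fin.rev i := Fin.rev_lt_rev.2 h
  exact add_lt_add_of_le_of_lt h1 h2

/-- The shifted parts are strictly decreasing, so `σ` composed with the inverse of `τ` is an
increasing permutation, hence the identity. -/
theorem RowPartition.eq_of_add_rev_comp_perm {q : ℕ} {μ ν : RowPartition q}
    {σ τ : Equiv.Perm (Fin q)}
    (h : ∀ i, μ.1 (σ i) + (Fin.rev (σ i) : ℕ) = ν.1 (τ i) + (Fin.rev (τ i) : ℕ)) :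
    μ = ν ∧ σ = τ := by
  set α := fun i => μ.1 i + (Fin.rev i : ℕ) with hα
  set β := fun i => ν.1 i + (Fin.rev i : ℕ) with hβ
  let ρ : Equiv.Perm (Fin q) := τ.symm.trans σ
  have hρ : ∀ i, α (ρ i) = β i := by
    intro i
    have := h (τ.symm i)
    simpa [ρ, hα, hβ] using this
  have hmono : StrictMono ρ := by
    intro i j hij
    have := ν.strictAnti_add_rev hij
    change β j < β i at this
    rw [← hρ, ← hρ] at this
    exact (μ.strictAnti_add_rev.lt_iff_gt).1 this
  have hid : (ρ : Fin q → Fin q) = id := by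
    refine (hmono.range_inj strictMono_id).1 ?_
    rw [ρ.surjective.range_eq, Set.range_id]
  constructor
  · ext i
    have := hρ i
    rw [hid] at this
    simpa [hα, hβ] using this
  · ext i
    have := congrFun hid (τ i)
    simpa [ρ] using congrArg Fin.val this

theorem torusMap_zero_ne_zero {p : ℕ} {R : Fin p → ℝ} (hR : ∀ i, 0 < R i) (θ : Fin p → ℝ)
    (i : Fin p) : torusMap 0 R θ i ≠ 0 := by
  simp [torusMap, (hR i).ne', Complex.exp_ne_zero]

theorem norm_torusMap_zero {p : ℕ} {R : Fin p → ℝ} (hR : ∀ i, 0 < R i) (θ : Fin p → ℝ)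
    (i : Fin p) : ‖torusMap 0 R θ i‖ = R i := by
  simp [torusMap, Complex.norm_exp_ofReal_mul_I, abs_of_pos (hR i)]

theorem continuous_torusMap_apply {p : ℕ} (c : Fin p → ℂ) (R : Fin p → ℝ) (i : Fin p) :
    Continuous fun θ => torusMap c R θ i := by
  unfold torusMap
  fun_prop

/-- Orthogonality of alternants on a torus. -/
theorem torusIntegral_alternant_mul_alternant_inv {p : ℕ} (μ ν : RowPartition p)
    {R : Fin p → ℝ} (hR : ∀ i, 0 < R i) :
    torusIntegral (fun y => (∏ i, (y i)⁻¹) * (alternant μ.1 y * alternant ν.1 fun i => (y i)⁻¹))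
      0 R = if μ = ν then p.factorial * (2 * (Real.pi : ℂ) * Complex.I) ^ p else 0 := by
  -- The final `- 1` is the weight `∏ 1/y_i`: a monomial integrates to something nonzero exactly
  -- when all these exponents are `-1`, that is, when the shifted parts agree.
  let e : Equiv.Perm (Fin p) → Equiv.Perm (Fin p) → Fin p → ℤ := fun σ τ i =>
    ((μ.1 (σ i) + (Fin.rev (σ i) : ℕ) : ℕ) : ℤ) - ((ν.1 (τ i) + (Fin.rev (τ i) : ℕ) : ℕ) : ℤ) - 1
  have hint : ∀ σ τ, TorusIntegrable (fun y => ((Equiv.Perm.sign σ : ℤ) : ℂ) *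
      ((Equiv.Perm.sign τ : ℤ) : ℂ) * ∏ i, y i ^ e σ τ i) 0 R := by
    intro σ τ
    refine torusIntegrable_of_continuous (continuous_const.mul
      (continuous_finsetProd _ fun i _ => ?_))
    exact (continuous_torusMap_apply 0 R i).zpow₀ _
      fun θ => Or.inl (torusMap_zero_ne_zero hR θ i)
  have h1 : torusIntegral (fun y => (∏ i, (y i)⁻¹) *
      (alternant μ.1 y * alternant ν.1 fun i => (y i)⁻¹)) 0 R =
      torusIntegral (fun y => ∑ s : Equiv.Perm (Fin p) × Equiv.Perm (Fin p),
        ((Equiv.Perm.sign s.1 : ℤ) : ℂ) * ((Equiv.Perm.sign s.2 : ℤ) : ℂ) *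
          ∏ i, y i ^ e s.1 s.2 i) 0 R := by
    refine torusIntegral_congr fun θ => ?_
    set y := torusMap 0 R θ
    have hy : ∀ i, y i ≠ 0 := torusMap_zero_ne_zero hR θ
    rw [alternant_eq_sum, alternant_eq_sum, Finset.sum_mul_sum, ← Finset.sum_product',
      Finset.mul_sum, Finset.univ_product_univ]
    refine Finset.sum_congr rfl fun s _ => ?_
    have : ∏ i, y i ^ e s.1 s.2 i = (∏ i, (y i)⁻¹) *
        ((∏ i, y i ^ (μ.1 (s.1 i) + (Fin.rev (s.1 i) : ℕ))) *
          ∏ i, (y i)⁻¹ ^ (ν.1 (s.2 i) + (Fin.rev (s.2 i) : ℕ))) := by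
      simp only [← Finset.prod_mul_distrib]
      refine Finset.prod_congr rfl fun i _ => ?_
      simp only [e]
      rw [zpow_sub₀ (hy i), zpow_sub₀ (hy i), zpow_natCast, zpow_natCast, zpow_one, inv_pow]
      ring
    rw [this]
    ring
  rw [h1, torusIntegral_finset_sum _ fun s _ => hint s.1 s.2]
  simp only [torusIntegral_const_mul, torusIntegral_prod_zpow _ hR]
  have he : ∀ σ τ, (∀ i, e σ τ i = -1) ↔ μ = ν ∧ σ = τ := by
    intro σ τ
    constructor
    · intro h
      refine RowPartition.eq_of_add_rev_comp_perm fun i => ?_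
      have := h i
      simp only [e] at this
      omega
    · rintro ⟨rfl, rfl⟩ i
      simp [e]
  simp only [he]
  split_ifs with hμ
  · simp only [hμ, true_and]
    rw [Fintype.sum_prod_type]
    simp only [mul_ite, mul_zero, Finset.sum_ite_eq, Finset.mem_univ, if_true]
    have hsq : ∀ σ : Equiv.Perm (Fin p), ((Equiv.Perm.sign σ : ℤ) : ℂ) *
        ((Equiv.Perm.sign σ : ℤ) : ℂ) = 1 := by
      intro σ
      rcases Int.units_eq_one_or (Equiv.Perm.sign σ) with h | h <;> simp [h]
    simp [hsq, Fintype.card_perm]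
  · simp [hμ]

theorem pi_mul_norm_lt_one {p : ℕ} {t : ℂ} {R : Fin p → ℝ} (h : ∀ i, ‖t‖ * ‖R i‖ < 1) :
    ‖t‖ * ‖R‖ < 1 := by
  rcases (norm_nonneg t).eq_or_lt with h0 | h0
  · rw [← h0, zero_mul]; exact one_pos
  · rw [mul_comm, ← lt_div_iff₀ h0]
    exact (pi_norm_lt_iff (by positivity)).2 fun i => by
      rw [lt_div_iff₀ h0, mul_comm]; exact h i

set_option maxHeartbeats 2000000 in
/-- Pairing of an alternant series with the sum of all alternants over a torus. -/
theorem torusIntegral_tsum_alternant {p : ℕ} (g : RowPartition p → ℂ) (C : ℝ)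
    (hg : ∀ μ, ‖g μ‖ ≤ C) (t : ℂ) {R : Fin p → ℝ} (hR : ∀ i, 1 < R i) (ht : ∀ i, ‖t‖ * R i < 1) :
    torusIntegral (fun y => (∏ i, (y i)⁻¹) *
      ((∑' μ : RowPartition p, g μ * (t ^ μ.size * alternant μ.1 y)) *
        ∑' ν : RowPartition p, alternant ν.1 fun i => (y i)⁻¹)) 0 R =
      (p.factorial * (2 * (Real.pi : ℂ) * Complex.I) ^ p) *
        ∑' μ : RowPartition p, g μ * t ^ μ.size := by
  have hR0 : ∀ i, 0 < R i := fun i => one_pos.trans (hR i)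
  obtain ⟨ρ, hρ0, hρ1, hρ⟩ := exists_common_bound (fun i => ((R i : ℂ))⁻¹) (fun i => by
    rw [norm_inv, Complex.norm_real, Real.norm_of_nonneg (hR0 i).le]
    exact inv_lt_one_of_one_lt₀ (hR i))
  have hC : 0 ≤ C := (norm_nonneg _).trans (hg ⟨0, fun _ _ _ => le_rfl⟩)
  have hr1 : ‖t‖ * ‖R‖ < 1 := pi_mul_norm_lt_one fun i => by
    rw [Real.norm_of_nonneg (hR0 i).le]; exact ht i
  set K : ℝ → ℝ := fun r => p.factorial * r ^ ∑ i : Fin p, (Fin.rev i : ℕ) with hK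
  have hb1 : ∀ (μ : RowPartition p) θ, ‖g μ * (t ^ μ.size * alternant μ.1 (torusMap 0 R θ))‖ ≤
      C * K ‖R‖ * (‖t‖ * ‖R‖) ^ μ.size := by
    intro μ θ
    have h := norm_alternant_le μ.1 (torusMap 0 R θ) (r := ‖R‖) fun i => by
      rw [norm_torusMap_zero hR0, ← Real.norm_of_nonneg (hR0 i).le]
      exact norm_le_pi_norm R i
    rw [norm_mul, norm_mul, norm_pow, mul_assoc]
    refine mul_le_mul (hg μ) ?_ (by positivity) hC
    refine (mul_le_mul_of_nonneg_left h (by positivity)).trans_eq ?_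
    rw [mul_pow]
    simp only [hK, RowPartition.size]
    ring
  have hb2 : ∀ (ν : RowPartition p) θ, ‖alternant ν.1 fun i => (torusMap 0 R θ i)⁻¹‖ ≤
      K (ρ ^ 2) * (ρ ^ 2) ^ ν.size := by
    intro ν θ
    refine norm_alternant_le ν.1 _ fun i => ?_
    have := hρ i
    rw [norm_inv, Complex.norm_real, Real.norm_of_nonneg (hR0 i).le] at this
    rw [norm_inv, norm_torusMap_zero hR0]
    exact this
  have hs1 : Summable fun μ : RowPartition p => C * K ‖R‖ * (‖t‖ * ‖R‖) ^ μ.size :=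
    (summable_pow_size p (by positivity) hr1).mul_left _
  have hs2 : Summable fun ν : RowPartition p => K (ρ ^ 2) * (ρ ^ 2) ^ ν.size :=
    (summable_pow_size p (by positivity) (by nlinarith)).mul_left _
  let f : RowPartition p × RowPartition p → (Fin p → ℂ) → ℂ := fun s y => (g s.1 * t ^ s.1.size) *
    ((∏ i, (y i)⁻¹) * (alternant s.1.1 y * alternant s.2.1 fun i => (y i)⁻¹))
  have hinv : ∀ i, Continuous fun θ => (torusMap 0 R θ i)⁻¹ := fun i =>
    (continuous_torusMap_apply 0 R i).inv₀ fun θ => torusMap_zero_ne_zero hR0 θ i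
  have hprod : ∀ θ, ‖∏ i, (torusMap 0 R θ i)⁻¹‖ ≤ 1 := by
    intro θ
    rw [norm_prod]
    refine Finset.prod_le_one (fun _ _ => norm_nonneg _) fun i _ => ?_
    rw [norm_inv, norm_torusMap_zero hR0]
    exact inv_le_one_of_one_le₀ (hR i).le
  have hsum := hasSum_torusIntegral (f := f) (c := 0) (R := R)
    (u := fun s => (C * K ‖R‖ * (‖t‖ * ‖R‖) ^ s.1.size) * (K (ρ ^ 2) * (ρ ^ 2) ^ s.2.size))
    (fun s => continuous_const.mul ((continuous_finsetProd _ fun i _ => hinv i).mul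
      (((continuous_alternant s.1.1).comp
        (continuous_pi fun i => continuous_torusMap_apply 0 R i)).mul
        ((continuous_alternant s.2.1).comp (continuous_pi hinv)))))
    (fun s θ => by
      have h : f s (torusMap 0 R θ) = (∏ i, (torusMap 0 R θ i)⁻¹) *
          ((g s.1 * (t ^ s.1.size * alternant s.1.1 (torusMap 0 R θ))) *
            alternant s.2.1 fun i => (torusMap 0 R θ i)⁻¹) := by
        simp only [f]; ring
      rw [h, norm_mul, norm_mul]
      refine (mul_le_of_le_one_left (by positivity) (hprod θ)).trans ?_
      exact mul_le_mul (hb1 _ θ) (hb2 _ θ) (norm_nonneg _) ((norm_nonneg _).trans (hb1 _ θ)))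
    (hs1.mul_of_nonneg hs2 (fun μ => (norm_nonneg _).trans (hb1 μ 0))
      fun ν => (norm_nonneg _).trans (hb2 ν 0))
  have hleft : torusIntegral (fun y => (∏ i, (y i)⁻¹) *
      ((∑' μ : RowPartition p, g μ * (t ^ μ.size * alternant μ.1 y)) *
        ∑' ν : RowPartition p, alternant ν.1 fun i => (y i)⁻¹)) 0 R =
      torusIntegral (fun y => ∑' s, f s y) 0 R := by
    refine torusIntegral_congr fun θ => ?_
    rw [tsum_mul_tsum_of_summable_norm
      (Summable.of_nonneg_of_le (fun _ => norm_nonneg _) (fun μ => hb1 μ θ) hs1)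
      (Summable.of_nonneg_of_le (fun _ => norm_nonneg _) (fun μ => hb2 μ θ) hs2), ← tsum_mul_left]
    refine tsum_congr fun s => ?_
    simp only [f]; ring
  have hterm : ∀ s, torusIntegral (f s) 0 R = g s.1 * t ^ s.1.size *
      if s.1 = s.2 then p.factorial * (2 * (Real.pi : ℂ) * Complex.I) ^ p else 0 := by
    intro s
    rw [← torusIntegral_alternant_mul_alternant_inv s.1 s.2 hR0, ← torusIntegral_const_mul]
  -- Once the double series is integrated termwise, orthogonality leaves only its diagonal.
  rw [hleft, ← hsum.tsum_eq, hsum.summable.tsum_prod]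
  simp only [hterm]
  rw [← tsum_mul_left]
  refine tsum_congr fun μ => ?_
  rw [tsum_mul_left]
  simp only [eq_comm (a := μ), tsum_ite_eq]
  ring

/-! ### Matching the integrand and assembling the formula. -/

theorem sum_val_rev (p : ℕ) : ∑ i : Fin p, (Fin.rev i : ℕ) = p.choose 2 := by
  have h := Equiv.sum_comp Fin.revPerm fun i : Fin p => (i : ℕ)
  simp only [Fin.revPerm_apply] at h
  rw [h, Fin.sum_univ_eq_sum_range (fun i => i) p,
    Finset.sum_range_id, Nat.choose_two_right]

theorem sub_one_ne_zero_of_one_lt_norm {z : ℂ} (h : 1 < ‖z‖) : z - 1 ≠ 0 := by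
  intro h0
  rw [sub_eq_zero.1 h0] at h
  simp at h

theorem one_lt_norm_mul {z w : ℂ} (hz : 1 < ‖z‖) (hw : 1 < ‖w‖) : 1 < ‖z * w‖ := by
  rw [norm_mul]; exact one_lt_mul_of_lt_of_le hz hw.le

/-- Clearing denominators turns `y_i⁻¹ - y_j⁻¹` into `-(y_i - y_j)`, one sign for each of the
`p.choose 2` pairs; the weight `∏ 1/y_i` turns `1 - y_i⁻¹` into `y_i - 1`. -/
theorem prod_inv_mul_littlewoodProd_inv {p : ℕ} (y : Fin p → ℂ) (hy : ∀ i, 1 < ‖y i‖) :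
    (∏ i, (y i)⁻¹) * littlewoodProd (fun i => (y i)⁻¹) = (-1) ^ p.choose 2 *
      ((∏ i, 1 / (y i - 1)) * ∏ i, ∏ j ∈ Finset.Ioi i, (y i - y j) / (y i * y j - 1)) := by
  have h0 : ∀ i, y i ≠ 0 := fun i h => by
    have := hy i
    rw [h, norm_zero] at this
    linarith
  have h1 : (∏ i, (y i)⁻¹) * ∏ i, 1 / (1 - (y i)⁻¹) = ∏ i, 1 / (y i - 1) := by
    rw [← Finset.prod_mul_distrib]
    refine Finset.prod_congr rfl fun i _ => ?_
    rw [one_div, one_div, ← mul_inv, mul_sub, mul_inv_cancel₀ (h0 i), mul_one]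
  have h2 : ∏ i, ∏ j ∈ Finset.Ioi i, ((y i)⁻¹ - (y j)⁻¹) / (1 - (y i)⁻¹ * (y j)⁻¹) =
      (-1) ^ p.choose 2 * ∏ i, ∏ j ∈ Finset.Ioi i, (y i - y j) / (y i * y j - 1) := by
    rw [← sum_val_rev, ← prod_prod_Ioi_const, ← Finset.prod_mul_distrib]
    refine Finset.prod_congr rfl fun i _ => ?_
    rw [← Finset.prod_mul_distrib]
    refine Finset.prod_congr rfl fun j _ => ?_
    have hi := h0 i
    have hj := h0 j
    have hij := sub_one_ne_zero_of_one_lt_norm (one_lt_norm_mul (hy i) (hy j))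
    have hij' : 1 - (y i)⁻¹ * (y j)⁻¹ ≠ 0 := by
      rw [← mul_inv]
      intro h
      refine hij ?_
      rw [sub_eq_zero] at h ⊢
      rw [← inv_inv (y i * y j), ← h, inv_one]
    rw [← mul_div_assoc, div_eq_div_iff hij' hij]
    field_simp
    ring
  rw [littlewoodProd, ← mul_assoc, h1, h2]
  ring

theorem torusIntegrand_eq {m p : ℕ} (x : Fin m → ℂ) (t : ℂ) (y : Fin p → ℂ)
    (hy : ∀ i, 1 < ‖y i‖) :
    torusIntegrand x t y = (-1) ^ p.choose 2 * ((∏ i, (y i)⁻¹) *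
      (((∏ i, ∏ j, 1 / (1 - x i * t * y j)) * ((∏ i, 1 / (1 - t * y i)) *
        ∏ i, ∏ j ∈ Finset.Ioi i, (y i - y j) / (1 - t ^ 2 * y i * y j))) *
        littlewoodProd fun i => (y i)⁻¹)) := by
  have hsign : ((-1 : ℂ) ^ p.choose 2) * (-1) ^ p.choose 2 = 1 := by rw [← mul_pow]; simp
  have h1 : ∏ i, ∏ j ∈ Finset.Ioi i, (y i - y j) ^ 2 / (1 - t ^ 2 * y i * y j) =
      (∏ i, ∏ j ∈ Finset.Ioi i, (y i - y j) / (1 - t ^ 2 * y i * y j)) *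
        ∏ i, ∏ j ∈ Finset.Ioi i, (y i - y j) := by
    simp only [← Finset.prod_mul_distrib]
    refine Finset.prod_congr rfl fun i _ => Finset.prod_congr rfl fun j _ => ?_
    ring
  have h2 : ∏ i, ∏ j ∈ Finset.Ioi i, (y i - y j) / (y i * y j - 1) =
      (∏ i, ∏ j ∈ Finset.Ioi i, (y i - y j)) *
        ∏ i, ∏ j ∈ Finset.Ioi i, 1 / (y i * y j - 1) := by
    simp only [← Finset.prod_mul_distrib]
    refine Finset.prod_congr rfl fun i _ => Finset.prod_congr rfl fun j _ => ?_
    ring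
  have h3 := prod_inv_mul_littlewoodProd_inv y hy
  rw [mul_left_comm (∏ i, (y i)⁻¹), h3, h2, torusIntegrand, h1]
  rw [show ∀ s a b : ℂ, s * (a * (s * b)) = (s * s) * (a * b) by intros; ring, hsign]
  ring

theorem torusIntegrable_torusIntegrand {m p : ℕ} (x : Fin m → ℂ) (hx : ∀ i, ‖x i‖ < 1) (t : ℂ)
    {R : Fin p → ℝ} (hR : ∀ i, 1 < R i) (ht : ∀ i, ‖t‖ * R i < 1) :
    TorusIntegrable (torusIntegrand x t) 0 R := by
  have hn := norm_torusMap_zero fun i => one_pos.trans (hR i)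
  have hc := continuous_torusMap_apply 0 R
  have hy : ∀ θ i, 1 < ‖torusMap 0 R θ i‖ := fun θ i => by rw [hn]; exact hR i
  have hty : ∀ θ i, ‖t * torusMap 0 R θ i‖ < 1 := fun θ i => by
    rw [norm_mul, hn]; exact ht i
  refine torusIntegrable_of_continuous ?_
  unfold torusIntegrand
  refine ((((?_ : Continuous _).mul ?_).mul ?_).mul ?_).mul ?_
  · refine continuous_finsetProd _ fun i _ => continuous_finsetProd _ fun j _ => ?_
    refine (((hc i).sub (hc j)).pow 2).div
      (continuous_const.sub ((continuous_const.mul (hc i)).mul (hc j))) fun θ => ?_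
    have := one_sub_mul_ne_zero (hty θ i) (hty θ j)
    rwa [show t * torusMap 0 R θ i * (t * torusMap 0 R θ j) =
      t ^ 2 * torusMap 0 R θ i * torusMap 0 R θ j by ring] at this
  · refine continuous_finsetProd _ fun i _ => continuous_finsetProd _ fun j _ => ?_
    refine continuous_const.div (continuous_const.sub (continuous_const.mul (hc j))) fun θ => ?_
    rw [mul_assoc]
    exact one_sub_mul_ne_zero (hx i) (hty θ j)
  · refine continuous_finsetProd _ fun i _ => ?_
    exact continuous_const.div (continuous_const.sub (continuous_const.mul (hc i)))
      fun θ => one_sub_ne_zero_of_norm_lt (hty θ i)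
  · refine continuous_finsetProd _ fun i _ => ?_
    exact continuous_const.div ((hc i).sub continuous_const)
      fun θ => sub_one_ne_zero_of_one_lt_norm (hy θ i)
  · refine continuous_finsetProd _ fun i _ => continuous_finsetProd _ fun j _ => ?_
    exact continuous_const.div (((hc i).mul (hc j)).sub continuous_const)
      fun θ => sub_one_ne_zero_of_one_lt_norm (one_lt_norm_mul (hy θ i) (hy θ j))

theorem schurProd_mul_torusIntegral {m q : ℕ} (x : Fin m → ℂ) (hx : ∀ i, ‖x i‖ < 1) (t : ℂ)
    {R : Fin (q + 1) → ℝ} (hR : ∀ i, 1 < R i) (ht : ∀ i, ‖t‖ * R i < 1) :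
    schurProd x * torusIntegral (torusIntegrand x t) 0 R = (-1) ^ (q + 1).choose 2 *
      (((q + 1).factorial * (2 * (Real.pi : ℂ) * Complex.I) ^ (q + 1)) *
        ∑' μ : RowPartition (q + 1), outerSkewSum x μ * t ^ μ.size) := by
  obtain ⟨C, hC⟩ := exists_norm_outerSkewSum_le x hx (q + 1)
  rw [← torusIntegral_tsum_alternant _ C hC t hR ht, ← torusIntegral_const_mul,
    ← torusIntegral_const_mul]
  refine torusIntegral_congr fun θ => ?_
  have hn := norm_torusMap_zero (fun i => one_pos.trans (hR i)) θ
  have hy : ∀ i, 1 < ‖torusMap 0 R θ i‖ := fun i => by rw [hn]; exact hR i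
  rw [torusIntegrand_eq x t _ hy, tsum_outerSkewSum_pow_alternant x hx q t _
    (fun i => by rw [norm_mul, hn]; exact ht i), tsum_alternant q _ (fun i => by
      rw [norm_inv]; exact inv_lt_one_of_one_lt₀ (hy i))]
  ring

theorem summable_and_tsum_skewSchur_mul_pow {m q : ℕ} (x : Fin m → ℂ) (hx : ∀ i, ‖x i‖ < 1)
    (t : ℂ) (ht : ‖t‖ < 1) :
    (Summable fun s : RowPartition q × YoungDiagram => skewSchur s.2 s.1.toYD x * t ^ s.1.size) ∧
    ∑' s : RowPartition q × YoungDiagram, skewSchur s.2 s.1.toYD x * t ^ s.1.size =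
      ∑' μ : RowPartition q, outerSkewSum x μ * t ^ μ.size := by
  obtain ⟨B, hB⟩ := exists_tsum_skewSchurOver_le (fun i => ‖x i‖) (fun i => norm_nonneg _) hx q
  have hnn : ∀ lam mu : YoungDiagram, 0 ≤ skewSchurOver lam mu fun i => ‖x i‖ :=
    fun _ _ => skewSchurOver_nonneg _ _ fun i => norm_nonneg _
  have hs : Summable fun s : RowPartition q × YoungDiagram =>
      (skewSchurOver s.2 s.1.toYD fun i => ‖x i‖) * ‖t‖ ^ s.1.size := by
    refine (summable_prod_of_nonneg fun s => mul_nonneg (hnn _ _) (by positivity)).2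
      ⟨fun μ => (hB μ).1.mul_right (‖t‖ ^ μ.size), ?_⟩
    refine Summable.of_nonneg_of_le (fun μ => tsum_nonneg fun lam =>
      mul_nonneg (hnn _ _) (by positivity)) (fun μ => ?_)
      ((summable_pow_size q (norm_nonneg t) ht).mul_left B)
    dsimp only
    rw [tsum_mul_right]
    exact mul_le_mul_of_nonneg_right (hB μ).2 (by positivity)
  have hsum : Summable fun s : RowPartition q × YoungDiagram =>
      skewSchur s.2 s.1.toYD x * t ^ s.1.size := by
    refine Summable.of_norm_bounded hs fun s => ?_
    rw [norm_mul, norm_pow]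
    exact mul_le_mul_of_nonneg_right (norm_skewSchurOver_le s.2 s.1.toYD x) (by positivity)
  refine ⟨hsum, ?_⟩
  rw [hsum.tsum_prod]
  refine tsum_congr fun μ => ?_
  dsimp only
  rw [tsum_mul_right]
  rfl

/-- Dropping the bound `ℓ(λ) ≤ n` adds only zero terms, since nonvanishing forces `ℓ(λ) ≤ ℓ(μ) + (n
- k - 1) ≤ n`. -/
theorem summable_and_schurSum_eq (n k : ℕ) (hk : k + 1 ≤ n) (x : Fin (n - k - 1) → ℂ) (t : ℂ)
    (hx : ∀ i, ‖x i‖ < 1) (ht : ‖t‖ < 1) :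
    Summable (schurTerm n k x t) ∧
    schurSum n k x t = ∑' μ : RowPartition (k + 1), outerSkewSum x μ * t ^ μ.size := by
  obtain ⟨hs, heq⟩ := summable_and_tsum_skewSchur_mul_pow (q := k + 1) x hx t ht
  let e : PartPair n k → RowPartition (k + 1) × YoungDiagram := fun p =>
    (RowPartition.ofYD (k + 1) p.1.2, p.1.1)
  have htoYD : ∀ p : PartPair n k, (RowPartition.ofYD (k + 1) p.1.2).toYD = p.1.2 :=
    fun p => RowPartition.toYD_ofYD p.2.2
  have he : Function.Injective e := by
    intro p p' h
    refine Subtype.ext (Prod.ext (congrArg Prod.snd h) ?_)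
    rw [← htoYD p, ← htoYD p']
    exact congrArg (fun s => s.1.toYD) h
  have hterm : ∀ p, schurTerm n k x t p =
      skewSchur (e p).2 (e p).1.toYD x * t ^ (e p).1.size := by
    intro p
    simp only [e, schurTerm, ← RowPartition.card_toYD, htoYD]
  have hfun : schurTerm n k x t =
      (fun s : RowPartition (k + 1) × YoungDiagram => skewSchur s.2 s.1.toYD x * t ^ s.1.size) ∘ e :=
    funext hterm
  rw [← heq, schurSum, hfun]
  refine ⟨hs.comp_injective he, he.tsum_eq (f := fun s : RowPartition (k + 1) × YoungDiagram =>
    skewSchur s.2 s.1.toYD x * t ^ s.1.size) fun s hne => ?_⟩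
  have hlen : partLength s.2 ≤ n := by
    by_contra h
    refine hne ?_
    have := s.1.partLength_toYD_le
    simp only
    rw [skewSchur_eq_zero_of_partLength x (by omega), zero_mul]
  refine ⟨⟨(s.2, s.1.toYD), hlen, s.1.partLength_toYD_le⟩, Prod.ext ?_ rfl⟩
  exact RowPartition.toYD_injective (RowPartition.toYD_ofYD s.1.partLength_toYD_le)

theorem mainTheorem9 (n k : ℕ) (hk : k + 1 ≤ n) (x : Fin (n - k - 1) → ℂ) (t : ℂ)
    (hx : ∀ i, ‖x i‖ < 1) (ε : Fin (k + 1) → ℝ) (hε : ∀ i, 0 < ε i)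
    (ht : ∀ i, ‖t‖ * (1 + ε i) < 1) :
    Summable (schurTerm n k x t) ∧
    TorusIntegrable (torusIntegrand x t) (0 : Fin (k + 1) → ℂ) (fun i => 1 + ε i) ∧
    schurSum n k x t =
      (-1) ^ ((k + 1).choose 2) / ((k + 1).factorial : ℂ) *
      (∏ i, 1 / (1 - x i)) *
      (∏ i, ∏ j ∈ Finset.Ioi i, 1 / (1 - x i * x j)) *
      (1 / (2 * (Real.pi : ℂ) * Complex.I) ^ (k + 1) *
        torusIntegral (torusIntegrand x t) (0 : Fin (k + 1) → ℂ) (fun i => 1 + ε i)) := by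
  have hR : ∀ i, 1 < 1 + ε i := fun i => lt_add_of_pos_right 1 (hε i)
  have ht1 : ‖t‖ < 1 :=
    (le_mul_of_one_le_right (norm_nonneg t) (hR 0).le).trans_lt (ht 0)
  obtain ⟨hs, heq⟩ := summable_and_schurSum_eq n k hk x t hx ht1
  refine ⟨hs, torusIntegrable_torusIntegrand x hx t hR ht, ?_⟩
  have h := schurProd_mul_torusIntegral x hx t hR ht
  rw [← heq] at h
  have hsign : ((-1 : ℂ) ^ (k + 1).choose 2) * (-1) ^ (k + 1).choose 2 = 1 := by
    rw [← mul_pow]; simp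
  have hfac : ((k + 1).factorial : ℂ) ≠ 0 := by exact_mod_cast (k + 1).factorial_ne_zero
  have hpi : (2 * (Real.pi : ℂ) * Complex.I) ^ (k + 1) ≠ 0 :=
    pow_ne_zero _ Complex.two_pi_I_ne_zero
  have h2 : (∏ i, 1 / (1 - x i)) * (∏ i, ∏ j ∈ Finset.Ioi i, 1 / (1 - x i * x j)) =
    schurProd x := rfl
  calc schurSum n k x t = ((-1 : ℂ) ^ (k + 1).choose 2 * (-1) ^ (k + 1).choose 2) *
        schurSum n k x t := by rw [hsign, one_mul]
    _ = (-1) ^ ((k + 1).choose 2) / ((k + 1).factorial : ℂ) *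
        (1 / (2 * (Real.pi : ℂ) * Complex.I) ^ (k + 1)) * ((-1) ^ (k + 1).choose 2 *
      (((k + 1).factorial * (2 * (Real.pi : ℂ) * Complex.I) ^ (k + 1)) * schurSum n k x t)) := by
        generalize (2 * (Real.pi : ℂ) * Complex.I) ^ (k + 1) = w at hpi
        field_simp
    _ = _ := by
        rw [← h, ← h2]; ring
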